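/- A 1-limited automaton is a nondeterministic two-way machine on a tape that holds the input word $w\in\Sigma^*$ between a left and a right end-marker. It starts on the first cell after the left end-marker in a single initial state, it may change the content of a cell only during the first visit to it, it never changes the end-markers, and it accepts by passing the right end-marker in a final state. It is once-marking if in each computation it replaces the input symbol $\sigma$ of at most one cell with a marked version $\bar\sigma$ and never changes any other cell. One-way and two-way nondeterministic finite automata (1NFAs, 2NFAs) and one-way deterministic finite automata (1DFAs) have one initial state; 2NFAs use the same end-markers and the same acceptance condition. For $n>0$ let $$K_n=\{x_1\cdots x_k\cdot x \mid k>0,\ x_1,\dots,x_k,x\in\{a,b\}^n,\ \exists j\in\{1,\dots,k\},\ x_j=x\}.$$ **Theorem.** Let $M$ be a once-marking 1-limited automaton with $n$ states, over any finite input alphabet. Then the language of $M$ is accepted by a 1NFA with at most $n\cdot 2^{n^2}$ states, by a 2NFA with at most $n\cdot 2^{n^2}$ states, and by a complete 1DFA with at most $2^{n\cdot 2^{n^2}}$ states. So the cost of the simulation is exponential for 1NFAs and 2NFAs, and double exponential for 1DFAs. In the worst case these exponential and double exponential costs cannot be reduced: there is a constant $C$ such that for every $n>0$ the language $K_n$ is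 accepted by a once-marking 1-limited automaton with at most $C\cdot n$ states, which marks exactly one cell in each accepting computation, whereas every 1NFA accepting $K_n$ has at least $2^n$ states, every 2NFA accepting $K_n$ has at least $2^{(n-1)/2}$ states, and every 1DFA accepting $K_n$, even with undefined transitions, has at least $2^{2^n}$ states. -/

import Mathlib

/-- Head moves: one cell to the left or one cell to the right. -/
inductive HeadMove where
  | left
  | right

/-- What a tape cell can hold: the left end-marker, the right end-marker, or a symbol of `Γ`. -/
inductive TapeSymbol (Γ : Type*) where
  | lend
  | rend
  | sym (g : Γ)

/-- The content of cell `i` when the string `t` is on the tape, surrounded by the end-markers: the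
left end-marker is in cell `0`, the letters of `t` are in the cells `1, …, |t|`, and the right
end-marker is in cell `|t| + 1`. Other positions are not cells of the tape. -/
def tapeCell {Γ : Type*} (t : List Γ) : ℕ → Option (TapeSymbol Γ)
  | 0 => some TapeSymbol.lend
  | i + 1 =>
    match t[i]? with
    | some g => some (TapeSymbol.sym g)
    | none => if i = t.length then some TapeSymbol.rend else none

/-- `HeadMoves d i j`: the head goes from position `i` to position `j` by the move `d`. There is no
move to the left from position `0`, that is, the head cannot pass the left end-marker. -/
def HeadMoves : HeadMove → ℕ → ℕ → Prop
  | HeadMove.left, i, j => i = j + 1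
  | HeadMove.right, i, j => j = i + 1

/-- A nondeterministic machine with state set `Q`, input alphabet `α` and work alphabet consisting
of `Γ` and the two end-markers, where `α` is identified with a subset of `Γ` through `input`. The
machine can rewrite its tape cells, but it can never write an end-marker. It is a 1-limited
automaton if it moreover satisfies `RewritingMachine.IsOneLimited` below. -/
structure RewritingMachine (α Γ Q : Type*) where
  /-- the input alphabet as a part of the work alphabet -/
  input : α ↪ Γ
  /-- the transition function -/
  δ : Q → TapeSymbol Γ → Set (Q × Γ × HeadMove)
  /-- the initial state -/
  init : Q
  /-- the set of final states -/
  final : Set Q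

namespace RewritingMachine

/-- A configuration: the state, the position of the head, the tape content between the end-markers,
and the record of the cells in which the head has already made a move. -/
structure Config (Γ Q : Type*) where
  state : Q
  pos : ℕ
  tape : List Γ
  visited : Set ℕ

variable {α Γ Q : Type*}

/-- The initial configuration on input `w`: the head is on cell `1`. -/
def initial (M : RewritingMachine α Γ Q) (w : List α) : Config Γ Q where
  state := M.init
  pos := 1
  tape := w.map M.input
  visited := ∅

/-- The tape that results from writing `g` in cell `i`. The cells of the end-markers are never
modified, so that nothing changes if `i` is `0` or exceeds the length of `t`. -/
def write (t : List Γ) (i : ℕ) (g : Γ) : List Γ :=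
  match i with
  | 0 => t
  | j + 1 => t.set j g

/-- One move of the machine. There is no move once the right end-marker has been passed, since the
head then scans no cell. -/
def Step (M : RewritingMachine α Γ Q) (c c' : Config Γ Q) : Prop :=
  ∃ (s : TapeSymbol Γ) (g : Γ) (d : HeadMove),
    tapeCell c.tape c.pos = some s ∧
    (c'.state, g, d) ∈ M.δ c.state s ∧
    HeadMoves d c.pos c'.pos ∧
    c'.tape = write c.tape c.pos g ∧
    c'.visited = insert c.pos c.visited

/-- Some computation on input `w` leads to the configuration `c`. -/
def Reaches (M : RewritingMachine α Γ Q) (w : List α) (c : Config Γ Q) : Prop :=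
  Relation.ReflTransGen M.Step (M.initial w) c

/-- `c` is accepting: the state is final and the head has passed the right end-marker. -/
def IsAccepting (M : RewritingMachine α Γ Q) (c : Config Γ Q) : Prop :=
  c.state ∈ M.final ∧ c.pos = c.tape.length + 2

/-- The accepted language. -/
def language (M : RewritingMachine α Γ Q) : Language α :=
  {w | ∃ c, M.Reaches w c ∧ M.IsAccepting c}

/-- The machine is a 1-limited automaton: in every computation, the content of a cell is modified
only during the first visit to it. -/
def IsOneLimited (M : RewritingMachine α Γ Q) : Prop :=
  ∀ (w : List α) (c c' : Config Γ Q), M.Reaches w c → M.Step c c' →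
    c.pos ∈ c.visited → c'.tape = c.tape

end RewritingMachine

/-- The symbols of the alphabet `α` together with their marked versions: `Sum.inl a` is the plain
symbol `a`, and `Sum.inr a` is the marked version of `a`. -/
abbrev WithMarks (α : Type*) := α ⊕ α

/-- `t` is obtained from the input word `w` by replacing the symbol of exactly one cell with its
marked version. -/
def IsMarkedOnce {α : Type*} (w : List α) (t : List (WithMarks α)) : Prop :=
  ∃ (u v : List α) (a : α), w = u ++ a :: v ∧
    t = u.map Sum.inl ++ Sum.inr a :: v.map Sum.inl

namespace RewritingMachine

variable {α Q : Type*}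

/-- Once-marking 1-limited automata: 1-limited automata, over the work alphabet of plain and marked
input symbols, such that at any point of any computation, at most one cell has been changed, by
replacing its input symbol with the marked version, while all other cells hold the input. -/
structure IsOnceMarking (M : RewritingMachine α (WithMarks α) Q) : Prop where
  input_eq : ∀ a, M.input a = Sum.inl a
  oneLimited : M.IsOneLimited
  marks : ∀ (w : List α) (c : Config (WithMarks α) Q), M.Reaches w c →
    c.tape = w.map Sum.inl ∨ IsMarkedOnce w c.tape

/-- In each accepting computation, exactly one cell is replaced with its marked version. -/
def MarksWhenAccepting (M : RewritingMachine α (WithMarks α) Q) : Prop :=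
  ∀ (w : List α) (c : Config (WithMarks α) Q), M.Reaches w c → M.IsAccepting c →
    IsMarkedOnce w c.tape

end RewritingMachine

/-- A two-way nondeterministic finite automaton on inputs surrounded by end-markers. -/
structure TwoWayNFA (α Q : Type*) where
  /-- the transition function -/
  δ : Q → TapeSymbol α → Set (Q × HeadMove)
  /-- the initial state -/
  init : Q
  /-- the set of final states -/
  final : Set Q

namespace TwoWayNFA

variable {α Q : Type*}

/-- One move on input `w`; a configuration consists of the state and the position of the head. -/
def Step (M : TwoWayNFA α Q) (w : List α) (c c' : Q × ℕ) : Prop :=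
  ∃ (s : TapeSymbol α) (d : HeadMove),
    tapeCell w c.2 = some s ∧ (c'.1, d) ∈ M.δ c.1 s ∧ HeadMoves d c.2 c'.2

/-- The accepted language: the computation starts on cell `1` in the initial state, and accepts by
passing the right end-marker in a final state. -/
def language (M : TwoWayNFA α Q) : Language α :=
  {w | ∃ q ∈ M.final, Relation.ReflTransGen (M.Step w) (M.init, 1) (q, w.length + 2)}

end TwoWayNFA

/-- The one-way automaton has at most one initial state, and at most one transition for each state
and each symbol: it is a one-way deterministic automaton, possibly with undefined transitions. -/
def NFA.IsPartialDFA {α Q : Type*} (N : NFA α Q) : Prop :=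
  N.start.Subsingleton ∧ ∀ q a, (N.step q a).Subsingleton

/-- The language `K_n` of the words `x₁ ⋯ x_k x` with `k > 0`, all of `x₁, …, x_k, x` of length `n`,
and `x` one of `x₁, …, x_k`, over a two-letter alphabet. -/
def blockLanguage (n : ℕ) : Language Bool :=
  {w | ∃ (xs : List (List Bool)) (x : List Bool), xs ≠ [] ∧ (∀ y ∈ xs, y.length = n) ∧
    x.length = n ∧ x ∈ xs ∧ w = xs.flatten ++ x}

/-! Upper bounds. In a 1-limited automaton a cell is frozen after the first visit, so the visited
prefix influences the future only through its table: which states at its last cell can lead to which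
states when it is left to the right. The table of a prefix prolonged by one cell depends only on the
old table and the new symbol (`TwoWay.table_append_singleton`). A 1NFA can thus store the table and
the state at the first visit to the next cell, and guess the symbol written there. With `n` states
there are `n * 2 ^ n ^ 2` such pairs. `reaches_of_mem_eval` and `IsOneLimited.inPrefix_or_inFull`
give the two inclusions. The 1NFA is also a 2NFA that never turns, and the subset construction makes
it a 1DFA.

Lower bounds. On words of two blocks, `K_n` is the equality language, so the pairs `(x, x)` form a
fooling set for 1NFAs. The concatenation of a set `A` of blocks, followed by `x`, is in `K_n` iff `x
∈ A`; hence `K_n` has at least `2 ^ 2 ^ n` Nerode classes. Deterministic automata need a state for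
each of them. For a 2NFA with `k` states, the first-exit states and the table of a prefix determine
its class, and they take at most `2 ^ (k + k ^ 2)` values.

The small machine. It guesses a block, marks its first symbol, and in round `i` compares symbol `i`
of this block with all later symbols at indices congruent to `i` modulo `n`, remembering only the
last outcome, which concerns the last block. One counter modulo `n` suffices: comparing index `j` in
round `i`, it holds `i - j`. If `n` divides the length of the input, it is `i` at the right end. It
is kept on the way back and during the first move to the right from the mark, which turns it into
the counter of round `i + 1`. The first round, where `i = 0`, checks this divisibility. -/

/-! ### Two-way runs on a segment of cells -/

namespace TwoWay

variable {S Q : Type*}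

/-- One move of a two-way device that scans one of the cells `0, …, |l| - 1` of the segment `l`. -/
def Step (δ : Q → S → Set (Q × HeadMove)) (l : List S) (c c' : Q × ℕ) : Prop :=
  ∃ (s : S) (d : HeadMove), l[c.2]? = some s ∧ (c'.1, d) ∈ δ c.1 s ∧ HeadMoves d c.2 c'.2

/-- Runs inside the segment `l`; they may end by leaving `l` to the right. -/
def Run (δ : Q → S → Set (Q × HeadMove)) (l : List S) : Q × ℕ → Q × ℕ → Prop :=
  Relation.ReflTransGen (Step δ l)

/-- The pairs `(p, q)` such that some run from state `p` on the last cell of `l` leaves `l` to the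
right in state `q`. -/
def table (δ : Q → S → Set (Q × HeadMove)) (l : List S) : Set (Q × Q) :=
  {x | ∃ i, i + 1 = l.length ∧ Run δ l (x.1, i) (x.2, l.length)}

/-- A cell `s` is left to the left, and reached again after a run described by `τ`. -/
def Loop (δ : Q → S → Set (Q × HeadMove)) (τ : Set (Q × Q)) (s : S) (p p' : Q) : Prop :=
  ∃ r, (r, HeadMove.left) ∈ δ p s ∧ (r, p') ∈ τ

/-- A cell `s` that follows a segment with table `τ` is scanned in state `p`, and finally left to
the right in state `q`. -/
def Exits (δ : Q → S → Set (Q × HeadMove)) (τ : Set (Q × Q)) (s : S) (p q : Q) : Prop :=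
  ∃ p', Relation.ReflTransGen (Loop δ τ s) p p' ∧ (q, HeadMove.right) ∈ δ p' s

/-- The table of a segment with table `τ` prolonged by the cell `s`. -/
def extend (δ : Q → S → Set (Q × HeadMove)) (τ : Set (Q × Q)) (s : S) : Set (Q × Q) :=
  {x | Exits δ τ s x.1 x.2}

variable {δ : Q → S → Set (Q × HeadMove)}

theorem Step.append {l : List S} {c c' : Q × ℕ} (h : Step δ l c c') (l' : List S) :
    Step δ (l ++ l') c c' := by
  obtain ⟨s, d, h1, h2, h3⟩ := h
  refine ⟨s, d, ?_, h2, h3⟩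
  obtain ⟨hlt, -⟩ := List.getElem?_eq_some_iff.1 h1
  rw [List.getElem?_append_left hlt, h1]

theorem Run.append {l : List S} {c c' : Q × ℕ} (h : Run δ l c c') (l' : List S) :
    Run δ (l ++ l') c c' :=
  Relation.ReflTransGen.mono (fun _ _ h => Step.append h l') _ _ h

theorem run_of_length_le {l : List S} {c c' : Q × ℕ} (hc : l.length ≤ c.2)
    (h : Run δ l c c') : c = c' := by
  rcases Relation.ReflTransGen.cases_head h with h | ⟨b, ⟨s, d, h1, -⟩, -⟩
  · exact h
  · rw [List.getElem?_eq_none hc] at h1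
    cases h1

theorem Exits.run {l : List S} {s : S} {p q : Q} (h : Exits δ (table δ l) s p q) :
    Run δ (l ++ [s]) (p, l.length) (q, l.length + 1) := by
  obtain ⟨p', h1, h2⟩ := h
  induction h1 using Relation.ReflTransGen.head_induction_on with
  | refl => exact .single ⟨s, .right, by simp, h2, rfl⟩
  | head h _ ih =>
    obtain ⟨r, hr, i, hi, hrun⟩ := h
    refine .head (b := (r, i)) ⟨s, .left, by simp, hr, hi.symm⟩ ?_
    exact Relation.ReflTransGen.trans (hrun.append [s]) ih

/-- A run that leaves `l ++ [s]` splits at the first time that the last cell `s` is reached. -/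
theorem run_append_singleton {l : List S} {s : S} {q p : Q} {i : ℕ} (hi : i ≤ l.length) :
    Run δ (l ++ [s]) (q, i) (p, l.length + 1) ↔
      ∃ r, Run δ l (q, i) (r, l.length) ∧ Exits δ (table δ l) s r p := by
  constructor
  · intro h
    suffices H : ∀ c, Run δ (l ++ [s]) c (p, l.length + 1) → c.2 ≤ l.length →
        ∃ r, Run δ l c (r, l.length) ∧ Exits δ (table δ l) s r p from H _ h hi
    clear h hi q i
    intro c h
    induction h using Relation.ReflTransGen.head_induction_on with
    | refl => intro h; simp at h
    | @head c c' h hrun ih =>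
      intro hc
      obtain ⟨t, d, h1, h2, h3⟩ := h
      rcases hc.lt_or_eq with hlt | heq
      · rw [List.getElem?_append_left hlt] at h1
        obtain ⟨r, hr, he⟩ := ih (by cases d <;> simp only [HeadMoves] at h3 <;> omega)
        exact ⟨r, .head ⟨t, d, h1, h2, h3⟩ hr, he⟩
      · obtain ⟨q, i⟩ := c
        obtain ⟨q', i'⟩ := c'
        simp only at heq h1 h2 h3
        subst heq
        simp only [List.getElem?_concat_length, Option.some.injEq] at h1
        subst h1
        refine ⟨q, .refl, ?_⟩
        cases d with
        | right =>
          simp only [HeadMoves] at h3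
          have := run_of_length_le (by simp [h3]) hrun
          simp only [Prod.mk.injEq] at this
          exact ⟨q, .refl, this.1 ▸ h2⟩
        | left =>
          simp only [HeadMoves] at h3
          obtain ⟨r, hr, p', hp, he⟩ := ih (by simp only; omega)
          exact ⟨p', .head ⟨q', h2, i', h3.symm, hr⟩ hp, he⟩
  · rintro ⟨r, h1, h2⟩
    exact Relation.ReflTransGen.trans (h1.append [s]) h2.run

theorem table_append_singleton (l : List S) (s : S) :
    table δ (l ++ [s]) = extend δ (table δ l) s := by
  ext ⟨p, q⟩
  simp only [table, extend, Set.mem_ofPred_eq, List.length_append, List.length_singleton,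
    Nat.add_right_cancel_iff, exists_eq_left]
  rw [run_append_singleton le_rfl]
  constructor
  · rintro ⟨r, h, he⟩
    have := run_of_length_le le_rfl h
    simp only [Prod.mk.injEq, and_true] at this
    exact this ▸ he
  · exact fun h => ⟨p, .refl, h⟩

end TwoWay

/-! ### Tapes as segments of cells -/

/-- The left end-marker and the content of the cells that follow it. -/
def leftTape {Γ : Type*} (t : List Γ) : List (TapeSymbol Γ) :=
  TapeSymbol.lend :: t.map TapeSymbol.sym

@[simp] theorem length_leftTape {Γ : Type*} (t : List Γ) : (leftTape t).length = t.length + 1 := by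
  simp [leftTape]

theorem leftTape_append {Γ : Type*} (t u : List Γ) :
    leftTape (t ++ u) = leftTape t ++ u.map TapeSymbol.sym := by
  simp [leftTape]

theorem tapeCell_eq_getElem? {Γ : Type*} (t : List Γ) (i : ℕ) :
    tapeCell t i = (leftTape t ++ [TapeSymbol.rend])[i]? := by
  cases i with
  | zero => rfl
  | succ i =>
    simp only [tapeCell, leftTape, List.cons_append, List.getElem?_cons_succ]
    rcases lt_trichotomy i t.length with h | h | h
    · rw [List.getElem?_append_left (by simpa using h)]
      simp [h]
    · subst h
      simp
    · rw [List.getElem?_eq_none h.le, List.getElem?_eq_none (by simpa using h)]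
      simp [h.ne']

theorem tapeCell_of_leftTape_append {Γ : Type*} {t t' : List Γ} {i : ℕ} {s : TapeSymbol Γ}
    (h : (leftTape t)[i]? = some s) : tapeCell (t ++ t') i = some s := by
  obtain ⟨hlt, -⟩ := List.getElem?_eq_some_iff.1 h
  rw [tapeCell_eq_getElem?, leftTape_append, List.append_assoc, List.getElem?_append_left hlt, h]

theorem TwoWayNFA.step_iff {α Q : Type*} (M : TwoWayNFA α Q) (w : List α) (c c' : Q × ℕ) :
    M.Step w c c' ↔ TwoWay.Step M.δ (leftTape w ++ [TapeSymbol.rend]) c c' := by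
  simp only [TwoWayNFA.Step, TwoWay.Step, tapeCell_eq_getElem?]

/-! ### Simulation of 1-limited automata by one-way automata -/

namespace RewritingMachine

variable {α Γ Q : Type*}

/-- The transitions that do not change the scanned symbol. -/
def readOnly (M : RewritingMachine α Γ Q) (q : Q) (s : TapeSymbol Γ) : Set (Q × HeadMove) :=
  {x | ∃ g, (x.1, g, x.2) ∈ M.δ q s ∧ ∀ g', s = TapeSymbol.sym g' → g = g'}

/-- On an end-marker `g` is arbitrary: `write` ignores position `0`, and at position `|t| + 1` the
index of `List.set` is out of range. -/
theorem write_eq_self {t : List Γ} {i : ℕ} {s : TapeSymbol Γ} {g : Γ} (hs : tapeCell t i = some s)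
    (hg : ∀ g', s = TapeSymbol.sym g' → g = g') : write t i g = t := by
  cases i with
  | zero => rfl
  | succ i =>
    simp only [write]
    rcases lt_or_ge i t.length with h | h
    · have : s = TapeSymbol.sym t[i] := by simpa [tapeCell, h] using hs.symm
      rw [hg _ this, List.set_getElem_self]
    · exact List.set_eq_of_length_le h

theorem eq_of_write_eq_self {t : List Γ} {i : ℕ} {s : TapeSymbol Γ} {g g' : Γ}
    (hs : tapeCell t i = some s) (h : write t i g = t) (hg : s = TapeSymbol.sym g') : g = g' := by
  subst hg
  cases i with
  | zero => simp [tapeCell] at hs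
  | succ i =>
    simp only [write] at h
    rcases lt_or_ge i t.length with hi | hi
    · have h1 : t[i] = g' := by simpa [tapeCell, hi] using hs
      have h2 : (t.set i g)[i]'(by simpa using hi) = t[i] := by simp only [h]
      rw [List.getElem_set_self] at h2
      rw [h2, h1]
    · simp only [tapeCell, List.getElem?_eq_none hi] at hs
      split_ifs at hs
      simp at hs

theorem Reaches.of_run {M : RewritingMachine α Γ Q} {w : List α} {t : List Γ}
    {l : List (TapeSymbol Γ)} (hl : ∀ i s, l[i]? = some s → tapeCell t i = some s)
    {c c' : Q × ℕ} (h : TwoWay.Run M.readOnly l c c')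
    (hc : ∃ vis, M.Reaches w ⟨c.1, c.2, t, vis⟩) : ∃ vis, M.Reaches w ⟨c'.1, c'.2, t, vis⟩ := by
  induction h with
  | refl => exact hc
  | tail _ h ih =>
    obtain ⟨vis, hv⟩ := ih
    obtain ⟨s, d, h1, ⟨g, h2, h3⟩, h4⟩ := h
    exact ⟨_, hv.tail ⟨s, g, d, hl _ _ h1, h2, h4, (write_eq_self (hl _ _ h1) h3).symm, rfl⟩⟩

/-- The nondeterministic one-way automaton that simulates a 1-limited automaton: after reading `u`
it stores the state in which cell `|u| + 1` is visited for the first time, together with the table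
of the cells before it. -/
def toNFA (M : RewritingMachine α Γ Q) : NFA α (Q × Set (Q × Q)) where
  step x a := {y | ∃ r g d, (r, g, d) ∈ M.δ x.1 (TapeSymbol.sym (M.input a)) ∧
    y.2 = TwoWay.extend M.readOnly x.2 (TapeSymbol.sym g) ∧
    ((d = HeadMove.right ∧ y.1 = r) ∨ (d = HeadMove.left ∧ ∃ r', (r, r') ∈ x.2 ∧
      TwoWay.Exits M.readOnly x.2 (TapeSymbol.sym g) r' y.1))}
  start := {(M.init, TwoWay.table M.readOnly (leftTape []))}
  accept := {x | ∃ p ∈ M.final, TwoWay.Exits M.readOnly x.2 TapeSymbol.rend x.1 p}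

/-- Soundness of the simulation. The tape `t` is made of the guessed symbols. It can be chosen
before the rest `v` of the input, because the cells of `v` have not yet been scanned. -/
theorem reaches_of_mem_eval {M : RewritingMachine α Γ Q} (u : List α) :
    ∀ x ∈ M.toNFA.eval u, ∃ t : List Γ, t.length = u.length ∧
      x.2 = TwoWay.table M.readOnly (leftTape t) ∧
      ∀ v, ∃ vis, M.Reaches (u ++ v) ⟨x.1, u.length + 1, t ++ v.map M.input, vis⟩ := by
  induction u using List.reverseRecOn with
  | nil =>
    rintro _ rfl
    exact ⟨[], rfl, rfl, fun v => ⟨∅, .refl⟩⟩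
  | append_singleton u a ih =>
    intro y hy
    rw [NFA.eval_append_singleton, NFA.mem_stepSet] at hy
    obtain ⟨x, hx, r, g, d, hδ, hτ, hy⟩ := hy
    obtain ⟨t, ht, hxt, hreach⟩ := ih x hx
    refine ⟨t ++ [g], by simp [ht], ?_, fun v => ?_⟩
    · rw [hτ, hxt, leftTape_append, List.map_singleton, TwoWay.table_append_singleton]
    obtain ⟨vis, hvis⟩ := hreach (a :: v)
    have hcell : tapeCell (t ++ (a :: v).map M.input) (u.length + 1) =
        some (TapeSymbol.sym (M.input a)) := by
      simp [tapeCell, ← ht]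
    have hwrite : write (t ++ (a :: v).map M.input) (u.length + 1) g =
        (t ++ [g]) ++ v.map M.input := by
      simp [write, ← ht]
    have hstep : ∀ i, HeadMoves d (u.length + 1) i → ∃ vis, M.Reaches ((u ++ [a]) ++ v)
        ⟨r, i, (t ++ [g]) ++ v.map M.input, vis⟩ := by
      intro i hi
      rw [List.append_assoc, List.singleton_append]
      exact ⟨_, hvis.tail ⟨_, g, d, hcell, hδ, hi, hwrite.symm, rfl⟩⟩
    rcases hy with ⟨rfl, hy⟩ | ⟨rfl, r', hr', he⟩
    · rw [hy]
      simpa using hstep (u.length + 1 + 1) rfl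
    · rw [hxt] at hr' he
      obtain ⟨i, hi, hrun⟩ := hr'
      rw [length_leftTape, ht] at hi
      have hl : ∀ i s, (leftTape t ++ [TapeSymbol.sym g])[i]? = some s →
          tapeCell ((t ++ [g]) ++ v.map M.input) i = some s := by
        intro i s hs
        refine tapeCell_of_leftTape_append ?_
        rwa [leftTape_append]
      have := Reaches.of_run hl (Relation.ReflTransGen.trans (hrun.append _) he.run)
        (hstep i hi.symm)
      simpa [ht] using this

/-- A configuration `c` that is reached with the head on a cell visited before, or at the first
unvisited cell `|u| + 1`, where `u` is a prefix of the input `w`. -/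
def InPrefix (M : RewritingMachine α Γ Q) (w : List α) (c : Config Γ Q) : Prop :=
  ∃ u v t, w = u ++ v ∧ c.tape = t ++ v.map M.input ∧ t.length = u.length ∧
    (∀ i, 1 ≤ i → i ≤ u.length → i ∈ c.visited) ∧ c.pos ≤ u.length + 1 ∧
    ∀ p, TwoWay.Run M.readOnly (leftTape t) (c.state, c.pos) (p, u.length + 1) →
      (p, TwoWay.table M.readOnly (leftTape t)) ∈ M.toNFA.eval u

/-- A configuration `c` that is reached after the whole input `w` has been visited. -/
def InFull (M : RewritingMachine α Γ Q) (w : List α) (c : Config Γ Q) : Prop :=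
  c.tape.length = w.length ∧ (∀ i, 1 ≤ i → i ≤ w.length → i ∈ c.visited) ∧
    ∀ p, TwoWay.Run M.readOnly (leftTape c.tape ++ [TapeSymbol.rend]) (c.state, c.pos)
        (p, w.length + 2) →
      ∃ q, (q, TwoWay.table M.readOnly (leftTape c.tape)) ∈ M.toNFA.eval w ∧
        TwoWay.Exits M.readOnly (TwoWay.table M.readOnly (leftTape c.tape)) TapeSymbol.rend q p

/-- On a visited input cell this is 1-limitedness; on an end-marker no move can alter the tape. -/
theorem IsOneLimited.readOnly_step {M : RewritingMachine α Γ Q} (hM : M.IsOneLimited) {w : List α}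
    {c c' : Config Γ Q} (hc : M.Reaches w c) (hvis : 1 ≤ c.pos → c.pos ≤ c.tape.length →
      c.pos ∈ c.visited) (h : M.Step c c') {l : List (TapeSymbol Γ)}
    (hl : l[c.pos]? = tapeCell c.tape c.pos) :
    c'.tape = c.tape ∧ TwoWay.Step M.readOnly l (c.state, c.pos) (c'.state, c'.pos) := by
  have htape : c'.tape = c.tape := by
    obtain ⟨s, g, d, h1, h2, h3, h4, h5⟩ := id h
    by_cases hp : 1 ≤ c.pos ∧ c.pos ≤ c.tape.length
    · exact hM w c c' hc h (hvis hp.1 hp.2)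
    · rw [h4]
      refine write_eq_self h1 fun g' hg' => ?_
      subst hg'
      rcases hpos : c.pos with _ | i
      · rw [hpos] at h1
        simp [tapeCell] at h1
      · rw [hpos] at h1 hp
        simp only [tapeCell, List.getElem?_eq_none (show c.tape.length ≤ i by omega)] at h1
        split_ifs at h1
        simp at h1
  refine ⟨htape, ?_⟩
  obtain ⟨s, g, d, h1, h2, h3, h4, h5⟩ := h
  exact ⟨s, d, hl.trans h1, ⟨g, h2, fun g' hg' => eq_of_write_eq_self h1 (h4 ▸ htape) hg'⟩, h3⟩

/-- Completeness of the simulation. Both invariants quantify over the read-only continuations of the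
configuration, so a move on a visited cell preserves them: it is prepended to the continuation. Only
the first visit to cell `|u| + 1` is simulated by a step of `toNFA`, with the symbol that is
actually written as the guess. -/
theorem IsOneLimited.inPrefix_or_inFull {M : RewritingMachine α Γ Q} (hM : M.IsOneLimited)
    {w : List α} {c : Config Γ Q} (h : M.Reaches w c) : M.InPrefix w c ∨ M.InFull w c := by
  induction h with
  | refl =>
    left
    refine ⟨[], w, [], rfl, rfl, rfl, fun i h1 h2 => absurd (h1.trans h2) (by simp), le_rfl,
      fun p hp => ?_⟩
    have := TwoWay.run_of_length_le (by simp [initial]) hp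
    simp only [Prod.mk.injEq] at this
    rw [← this.1]
    exact rfl
  | @tail c c' hc hstep ih =>
    obtain ⟨s, g, d, h1, h2, h3, h4, h5⟩ := id hstep
    rcases ih with ⟨u, v, t, rfl, htape, ht, hvis, hpos, hrun⟩ | ⟨hlen, hvis, hrun⟩
    · rcases hpos.lt_or_eq with hlt | heq
      · obtain ⟨htape', hro⟩ := hM.readOnly_step (l := leftTape t) hc
          (fun h1 _ => hvis _ h1 (by omega)) hstep (by
            rw [htape, tapeCell_eq_getElem?, leftTape_append, List.append_assoc,
              List.getElem?_append_left (by simpa [ht] using hlt)])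
        left
        refine ⟨u, v, t, rfl, htape'.trans htape, ht, fun i hi hi' => ?_, ?_,
          fun p hp => hrun p (.head hro hp)⟩
        · rw [h5]
          exact Set.mem_insert_of_mem _ (hvis i hi hi')
        · cases d <;> simp only [HeadMoves] at h3 <;> omega
      -- The first unvisited cell is reached now, so the empty continuation applies.
      · have hmem : (c.state, TwoWay.table M.readOnly (leftTape t)) ∈ M.toNFA.eval u :=
          hrun _ (by rw [heq]; exact .refl)
        cases v with
        | cons a v =>
          left
          have hs : s = TapeSymbol.sym (M.input a) := by
            rw [htape, heq] at h1
            simpa [tapeCell, ← ht] using h1.symm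
          subst hs
          refine ⟨u ++ [a], v, t ++ [g], by simp, ?_, by simp [ht], fun i hi hi' => ?_, ?_,
            fun p hp => ?_⟩
          · rw [h4, htape, heq]
            simp [write, ← ht]
          · rw [h5]
            rcases eq_or_ne i c.pos with hi2 | hi2
            · exact hi2 ▸ Set.mem_insert _ _
            · refine Set.mem_insert_of_mem _ (hvis i hi ?_)
              simp at hi'
              omega
          · simp only [List.length_append, List.length_singleton]
            cases d <;> simp only [HeadMoves] at h3 <;> omega
          · rw [NFA.eval_append_singleton, NFA.mem_stepSet]
            refine ⟨_, hmem, c'.state, g, d, h2, ?_, ?_⟩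
            · rw [leftTape_append, List.map_singleton, TwoWay.table_append_singleton]
            rw [leftTape_append, List.map_singleton] at hp
            cases d with
            | right =>
              simp only [HeadMoves] at h3
              have := TwoWay.run_of_length_le (by simp [h3, heq, ht]) hp
              simp only [Prod.mk.injEq] at this
              exact .inl ⟨rfl, this.1.symm⟩
            | left =>
              simp only [HeadMoves] at h3
              have hp' : TwoWay.Run M.readOnly (leftTape t ++ [TapeSymbol.sym g])
                  (c'.state, c'.pos) (p, (leftTape t).length + 1) := by
                simpa [ht] using hp
              rw [TwoWay.run_append_singleton (by simp; omega)] at hp'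
              obtain ⟨r, hr, he⟩ := hp'
              exact .inr ⟨rfl, r, ⟨c'.pos, by simp; omega, hr⟩, he⟩
        | nil =>
          right
          simp only [List.map_nil, List.append_nil] at htape hc ⊢
          subst htape
          obtain ⟨htape', hro⟩ := hM.readOnly_step (l := leftTape c.tape ++ [TapeSymbol.rend]) hc
            (fun h1 _ => hvis _ h1 (by omega)) hstep (tapeCell_eq_getElem? _ _).symm
          rw [InFull, htape']
          refine ⟨ht, fun i hi hi' => ?_, fun p hp => ⟨c.state, hmem, ?_⟩⟩
          · rw [h5]
            exact Set.mem_insert_of_mem _ (hvis i hi hi')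
          -- The continuation starts on the right end-marker, so that the part before the first
          -- arrival there is empty.
          · have hp' := Relation.ReflTransGen.head hro hp
            have hl : (leftTape c.tape).length + 1 = u.length + 2 := by simp [ht]
            rw [← hl] at hp'
            obtain ⟨r, hr, he⟩ := (TwoWay.run_append_singleton (by simp; omega)).1 hp'
            have := TwoWay.run_of_length_le (by simp; omega) hr
            simp only [Prod.mk.injEq] at this
            exact this.1 ▸ he
    · right
      obtain ⟨htape', hro⟩ := hM.readOnly_step (l := leftTape c.tape ++ [TapeSymbol.rend]) hc
        (fun h1 _ => hvis _ h1 (by omega)) hstep (tapeCell_eq_getElem? _ _).symm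
      rw [InFull, htape']
      refine ⟨hlen, fun i hi hi' => ?_, fun p hp => hrun p (.head hro hp)⟩
      rw [h5]
      exact Set.mem_insert_of_mem _ (hvis i hi hi')

theorem IsOneLimited.toNFA_accepts {M : RewritingMachine α Γ Q} (hM : M.IsOneLimited) :
    M.toNFA.accepts = M.language := by
  ext w
  constructor
  · rintro ⟨x, ⟨p, hp, he⟩, hx⟩
    obtain ⟨t, ht, hxt, hreach⟩ := reaches_of_mem_eval w x hx
    rw [hxt] at he
    obtain ⟨vis, hvis⟩ := hreach []
    simp only [List.map_nil, List.append_nil] at hvis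
    obtain ⟨vis, hvis⟩ := Reaches.of_run (t := t)
      (fun i s h => (tapeCell_eq_getElem? _ _).trans h) he.run
      ⟨vis, by simpa [ht] using hvis⟩
    exact ⟨_, hvis, hp, by simp⟩
  · rintro ⟨c, hc, hfin, hpos⟩
    rcases hM.inPrefix_or_inFull hc with ⟨u, v, t, rfl, htape, ht, -, hle, -⟩ | ⟨hlen, -, hrun⟩
    · rw [hpos, htape] at hle
      simp [ht] at hle
    · obtain ⟨q, hq, he⟩ := hrun c.state (by rw [hpos, hlen]; exact .refl)
      exact ⟨_, ⟨_, hfin, he⟩, hq⟩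

end RewritingMachine

/-! ### Conversions between finite automata -/

namespace NFA

variable {α σ σ' : Type*}

/-- An automaton with renamed states. -/
def mapStates (N : NFA α σ) (e : σ ≃ σ') : NFA α σ' where
  step q a := e.symm ⁻¹' N.step (e.symm q) a
  start := e.symm ⁻¹' N.start
  accept := e.symm ⁻¹' N.accept

theorem eval_mapStates (N : NFA α σ) (e : σ ≃ σ') (w : List α) :
    (N.mapStates e).eval w = e.symm ⁻¹' N.eval w := by
  induction w using List.reverseRecOn with
  | nil => rfl
  | append_singleton w a ih =>
    ext q
    simp only [eval_append_singleton, mem_stepSet, Set.mem_preimage, ih]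
    exact ⟨fun ⟨t, h⟩ => ⟨_, h⟩, fun ⟨t, h1, h2⟩ => ⟨e t, by simpa using h1, by simpa [mapStates] using h2⟩⟩

theorem accepts_mapStates (N : NFA α σ) (e : σ ≃ σ') : (N.mapStates e).accepts = N.accepts := by
  ext w
  change (∃ q ∈ (N.mapStates e).accept, q ∈ (N.mapStates e).eval w) ↔
    ∃ q ∈ N.accept, q ∈ N.eval w
  rw [eval_mapStates]
  exact ⟨fun ⟨q, h⟩ => ⟨_, h⟩, fun ⟨t, h1, h2⟩ =>
    ⟨e t, by simpa [mapStates] using h1, by simpa using h2⟩⟩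

/-- A one-way automaton as a two-way automaton that only moves to the right. -/
def toTwoWayNFA (N : NFA α σ) (q₀ : σ) : TwoWayNFA α σ where
  δ q s := {x | x.2 = HeadMove.right ∧ match s with
    | .lend => False
    | .rend => x.1 = q
    | .sym a => x.1 ∈ N.step q a}
  init := q₀
  final := N.accept

theorem toTwoWayNFA_language (N : NFA α σ) {q₀ : σ} (h₀ : N.start = {q₀}) :
    (N.toTwoWayNFA q₀).language = N.accepts := by
  ext w
  constructor
  · rintro ⟨q, hq, hrun⟩
    suffices H : ∀ c, Relation.ReflTransGen ((N.toTwoWayNFA q₀).Step w) (q₀, 1) c →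
        ∃ i, c.2 = i + 1 ∧ c.1 ∈ N.eval (w.take i) by
      obtain ⟨i, hi, hm⟩ := H _ hrun
      simp only at hi
      rw [List.take_of_length_le (by omega)] at hm
      exact ⟨q, hq, hm⟩
    intro c hc
    induction hc with
    | refl => exact ⟨0, rfl, by simp [h₀]⟩
    | @tail c c' _ hstep ih =>
      obtain ⟨i, hi, hm⟩ := ih
      obtain ⟨s, d, h1, ⟨rfl, h2⟩, h3⟩ := hstep
      refine ⟨i + 1, by rw [← hi]; exact h3, ?_⟩
      rw [hi] at h1
      rcases lt_or_ge i w.length with h | h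
      · have : s = .sym w[i] := by simpa [tapeCell, h] using h1.symm
        subst this
        rw [List.take_succ_eq_append_getElem h, eval_append_singleton, mem_stepSet]
        exact ⟨_, hm, h2⟩
      -- Here `i = |w|`: the right end-marker is passed in an unchanged state, and both prefixes
      -- `w.take i` and `w.take (i + 1)` are `w`.
      · simp only [tapeCell, List.getElem?_eq_none h] at h1
        split_ifs at h1
        obtain rfl := Option.some.inj h1
        rw [List.take_of_length_le (by omega)] at hm ⊢
        exact h2 ▸ hm
  · rintro ⟨q, hq, hm⟩
    refine ⟨q, hq, ?_⟩
    have H : ∀ i ≤ w.length, ∀ q ∈ N.eval (w.take i),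
        Relation.ReflTransGen ((N.toTwoWayNFA q₀).Step w) (q₀, 1) (q, i + 1) := by
      intro i
      induction i with
      | zero =>
        intro _ q hq
        simp only [List.take_zero, eval_nil, h₀, Set.mem_singleton_iff] at hq
        exact hq ▸ .refl
      | succ i ih =>
        intro hi q hq
        rw [List.take_succ_eq_append_getElem hi, eval_append_singleton, mem_stepSet] at hq
        obtain ⟨p, hp, hpq⟩ := hq
        exact (ih (by omega) p hp).tail
          ⟨.sym w[i], .right, by simp [tapeCell, show i < w.length from hi], ⟨rfl, hpq⟩, rfl⟩
    exact (H w.length le_rfl q (by simpa using hm)).tail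
      ⟨.rend, .right, by simp [tapeCell], ⟨rfl, rfl⟩, rfl⟩

end NFA

theorem RewritingMachine.IsOneLimited.exists_automata {α Γ Q : Type*} [Fintype Q]
    {M : RewritingMachine α Γ Q} (hM : M.IsOneLimited) :
    ∃ k, k = Fintype.card Q * 2 ^ (Fintype.card Q ^ 2) ∧
      (∃ N : NFA α (Fin k), (∃ q₀, N.start = {q₀}) ∧ N.accepts = M.language) ∧
      (∃ T : TwoWayNFA α (Fin k), T.language = M.language) ∧
      (∃ D : DFA α (Fin (2 ^ k)), D.accepts = M.language) := by
  classical
  let k := Fintype.card Q * 2 ^ (Fintype.card Q ^ 2)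
  have hcard : Fintype.card (Q × Set (Q × Q)) = k := by
    simp [k, Fintype.card_prod, Fintype.card_set, sq]
  let e : Q × Set (Q × Q) ≃ Fin k := Fintype.equivFinOfCardEq hcard
  let N := M.toNFA.mapStates e
  have hN : N.accepts = M.language := (M.toNFA.accepts_mapStates e).trans hM.toNFA_accepts
  have hstart : N.start = {e (M.init, TwoWay.table M.readOnly (leftTape []))} := by
    ext q
    exact e.symm_apply_eq
  refine ⟨k, rfl, ⟨N, ⟨_, hstart⟩, hN⟩, ⟨_, (N.toTwoWayNFA_language hstart).trans hN⟩,
    DFA.reindex (Fintype.equivFinOfCardEq (by simp [Fintype.card_set])) N.toDFA, ?_⟩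
  rw [DFA.accepts_reindex, NFA.toDFA_correct, hN]

/-! ### Lower bounds -/

/-- The decomposition of a word into blocks is unique: as `n > 0`, the length gives the number of
blocks. -/
theorem flatten_append_mem_blockLanguage {n : ℕ} (hn : 0 < n) {xs : List (List Bool)} {x : List Bool}
    (hxs : ∀ y ∈ xs, y.length = n) (hx : x.length = n) :
    xs.flatten ++ x ∈ blockLanguage n ↔ x ∈ xs := by
  constructor
  · rintro ⟨ys, y, -, hys, hy, hmem, heq⟩
    have hlen : xs.flatten.length = ys.flatten.length := by
      have := congrArg List.length heq
      simp only [List.length_append] at this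
      omega
    obtain ⟨h1, rfl⟩ := List.append_inj heq hlen
    have h2 : xs.map List.length = List.replicate xs.length n :=
      List.eq_replicate_iff.2 ⟨by simp, by simpa using hxs⟩
    have h3 : ys.map List.length = List.replicate ys.length n :=
      List.eq_replicate_iff.2 ⟨by simp, by simpa using hys⟩
    have h4 : xs.length * n = ys.length * n := by
      simpa [List.length_flatten, h2, h3] using hlen
    have : xs = ys := List.eq_iff_flatten_eq.2
      ⟨h1, by rw [h2, h3, Nat.eq_of_mul_eq_mul_right hn h4]⟩
    exact this ▸ hmem
  · exact fun h => ⟨xs, x, List.ne_nil_of_mem h, hxs, hx, h, rfl⟩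

theorem append_mem_blockLanguage {n : ℕ} (hn : 0 < n) {x y : List Bool} (hx : x.length = n)
    (hy : y.length = n) : x ++ y ∈ blockLanguage n ↔ x = y := by
  have := flatten_append_mem_blockLanguage hn (xs := [x]) (by simpa using hx) hy
  simpa [eq_comm] using this

/-- Fooling set: if accepting computations on `xx` and `yy` share the middle state, then `xy` is
accepted, hence `x = y`. -/
theorem two_pow_le_of_nfa {n k : ℕ} (hn : 0 < n) {N : NFA Bool (Fin k)}
    (hN : N.accepts = blockLanguage n) : 2 ^ n ≤ k := by
  have key : ∀ x : Fin n → Bool, ∃ q, q ∈ N.eval (List.ofFn x) ∧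
      List.ofFn x ∈ N.acceptsFrom {q} := by
    intro x
    have : List.ofFn x ++ List.ofFn x ∈ N.accepts := by
      rw [hN, append_mem_blockLanguage hn (by simp) (by simp)]
    obtain ⟨p, hp, hm⟩ := this
    rw [NFA.eval, NFA.evalFrom_append, NFA.mem_evalFrom_iff_exists] at hm
    obtain ⟨q, hq, hpq⟩ := hm
    exact ⟨q, hq, p, hp, hpq⟩
  choose f hf hf' using key
  have hinj : Function.Injective f := by
    intro x y hxy
    obtain ⟨p, hp, hpq⟩ := hf' y
    have : List.ofFn x ++ List.ofFn y ∈ N.accepts := by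
      refine ⟨p, hp, ?_⟩
      rw [NFA.eval, NFA.evalFrom_append, NFA.mem_evalFrom_iff_exists]
      exact ⟨f x, hf x, hxy ▸ hpq⟩
    rw [hN, append_mem_blockLanguage hn (by simp) (by simp)] at this
    exact List.ofFn_injective this
  simpa using Fintype.card_le_of_injective f hinj

/-- The concatenation of the words in the set `A` of words of length `n`. -/
noncomputable def blockConcat {n : ℕ} (A : Finset (Fin n → Bool)) : List Bool :=
  (A.toList.map List.ofFn).flatten

theorem blockConcat_append_mem {n : ℕ} (hn : 0 < n) (A : Finset (Fin n → Bool))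
    (x : Fin n → Bool) : blockConcat A ++ List.ofFn x ∈ blockLanguage n ↔ x ∈ A := by
  rw [blockConcat, flatten_append_mem_blockLanguage hn (by simp) (by simp),
    List.mem_map_of_injective List.ofFn_injective, Finset.mem_toList]

theorem blockConcat_append_append_mem {n : ℕ} (A : Finset (Fin n → Bool))
    (x : Fin n → Bool) : blockConcat A ++ (List.ofFn x ++ List.ofFn x) ∈ blockLanguage n := by
  refine ⟨A.toList.map List.ofFn ++ [List.ofFn x], List.ofFn x, by simp, ?_, by simp, by simp,
    by simp [blockConcat]⟩
  intro y hy
  simp only [List.mem_append, List.mem_map, List.mem_singleton] at hy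
  rcases hy with ⟨z, -, rfl⟩ | rfl <;> simp

/-- An assignment of objects to words that refines the Nerode congruence of `blockLanguage n`
takes at least `2 ^ 2 ^ n` values. -/
theorem injective_comp_blockConcat {n : ℕ} (hn : 0 < n) {X : Type*} (f : List Bool → X)
    (hf : ∀ u v, f u = f v → ∀ z, u ++ z ∈ blockLanguage n → v ++ z ∈ blockLanguage n) :
    Function.Injective fun A : Finset (Fin n → Bool) => f (blockConcat A) := by
  intro A B h
  ext x
  rw [← blockConcat_append_mem hn, ← blockConcat_append_mem hn]
  exact ⟨hf _ _ h _, hf _ _ h.symm _⟩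

theorem card_finset_words (n : ℕ) : Fintype.card (Finset (Fin n → Bool)) = 2 ^ 2 ^ n := by
  simp

theorem NFA.IsPartialDFA.subsingleton_eval {α σ : Type*} {N : NFA α σ} (hN : N.IsPartialDFA)
    (w : List α) : (N.eval w).Subsingleton := by
  induction w using List.reverseRecOn with
  | nil => exact hN.1
  | append_singleton w a ih =>
    intro p hp q hq
    rw [NFA.eval_append_singleton, NFA.mem_stepSet] at hp hq
    obtain ⟨p', hp', hp⟩ := hp
    obtain ⟨q', hq', hq⟩ := hq
    obtain rfl := ih hp' hq'
    exact hN.2 _ _ hp hq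

/-- Undefined transitions save no state here: each `blockConcat A`, even for empty `A`, has a
continuation in the language, so a state is reached after it. -/
theorem two_pow_two_pow_le_of_isPartialDFA {n k : ℕ} (hn : 0 < n) {N : NFA Bool (Fin k)}
    (hdet : N.IsPartialDFA) (hN : N.accepts = blockLanguage n) : 2 ^ 2 ^ n ≤ k := by
  have key : ∀ A : Finset (Fin n → Bool), ∃ q, q ∈ N.eval (blockConcat A) := by
    intro A
    have := blockConcat_append_append_mem A (fun _ => true)
    rw [← hN] at this
    obtain ⟨p, -, hm⟩ := this
    rw [NFA.eval, NFA.evalFrom_append, NFA.mem_evalFrom_iff_exists] at hm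
    obtain ⟨q, hq, -⟩ := hm
    exact ⟨q, hq⟩
  choose f hf using key
  have hinj : Function.Injective f := by
    intro A B hAB
    refine injective_comp_blockConcat hn N.eval (fun u v huv z hz => ?_) ?_
    · rw [← hN] at hz ⊢
      obtain ⟨p, hp, hm⟩ := hz
      refine ⟨p, hp, ?_⟩
      rw [NFA.eval, NFA.evalFrom_append] at hm ⊢
      exact (show N.evalFrom N.start u = N.evalFrom N.start v from huv) ▸ hm
    · ext q
      have hA := hf A
      have hB := hf B
      constructor
      · intro hq
        rw [hdet.subsingleton_eval _ hq hA, hAB]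
        exact hB
      · intro hq
        rw [hdet.subsingleton_eval _ hq hB, ← hAB]
        exact hA
  simpa only [card_finset_words, Fintype.card_fin] using Fintype.card_le_of_injective f hinj

/-! ### Nerode classes and two-way automata -/

namespace TwoWayNFA

variable {α Q : Type*}

/-- The states in which the prefix `u` of an input can be left to the right for the first time,
and the table of this prefix. -/
def summary (T : TwoWayNFA α Q) (u : List α) : Set Q × Set (Q × Q) :=
  ({p | TwoWay.Run T.δ (leftTape u) (T.init, 1) (p, u.length + 1)},
    TwoWay.table T.δ (leftTape u))

theorem run_leftTape_append_singleton (T : TwoWayNFA α Q) (u : List α) (s : TapeSymbol α) (p : Q) :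
    TwoWay.Run T.δ (leftTape u ++ [s]) (T.init, 1) (p, u.length + 2) ↔
      ∃ r ∈ (T.summary u).1, TwoWay.Exits T.δ (T.summary u).2 s r p := by
  have := TwoWay.run_append_singleton (δ := T.δ) (l := leftTape u) (s := s) (q := T.init)
    (p := p) (i := 1) (by simp)
  rw [length_leftTape] at this
  exact this

/-- Since the right side depends on `u` only through its summary, equality of summaries is a right
congruence. -/
theorem summary_append_singleton (T : TwoWayNFA α Q) (u : List α) (a : α) :
    T.summary (u ++ [a]) =
      ({p | ∃ r ∈ (T.summary u).1, TwoWay.Exits T.δ (T.summary u).2 (.sym a) r p},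
        TwoWay.extend T.δ (T.summary u).2 (.sym a)) := by
  refine Prod.ext ?_ ?_
  · ext p
    refine Iff.trans ?_ (T.run_leftTape_append_singleton u (.sym a) p)
    simp [summary, leftTape_append]
  · simp only [summary, leftTape_append, List.map_singleton, TwoWay.table_append_singleton]

theorem mem_language_iff_summary (T : TwoWayNFA α Q) (w : List α) :
    w ∈ T.language ↔
      ∃ p ∈ T.final, ∃ r ∈ (T.summary w).1, TwoWay.Exits T.δ (T.summary w).2 .rend r p := by
  have h : ∀ p, Relation.ReflTransGen (T.Step w) (T.init, 1) (p, w.length + 2) ↔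
      ∃ r ∈ (T.summary w).1, TwoWay.Exits T.δ (T.summary w).2 .rend r p := by
    intro p
    rw [← T.run_leftTape_append_singleton w .rend p, TwoWay.Run]
    have : T.Step w = TwoWay.Step T.δ (leftTape w ++ [TapeSymbol.rend]) := by
      funext c c'
      exact propext (T.step_iff w c c')
    rw [this]
  simp only [← h]
  rfl

theorem summary_append_congr (T : TwoWayNFA α Q) {u v : List α} (h : T.summary u = T.summary v)
    (z : List α) : T.summary (u ++ z) = T.summary (v ++ z) := by
  induction z using List.reverseRecOn with
  | nil => simpa using h
  | append_singleton z a ih =>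
    rw [← List.append_assoc, ← List.append_assoc, summary_append_singleton,
      summary_append_singleton, ih]

end TwoWayNFA

/-- There are `2 ^ k * 2 ^ (k ^ 2)` possible summaries, and at least `2 ^ 2 ^ n` of them occur; the
bound compares the exponents. -/
theorem two_pow_le_of_twoWayNFA {n k : ℕ} (hn : 0 < n) {T : TwoWayNFA Bool (Fin k)}
    (hT : T.language = blockLanguage n) : 2 ^ n ≤ k + k ^ 2 := by
  classical
  have hinj := injective_comp_blockConcat hn T.summary (fun u v huv z hz => by
    rw [← hT, T.mem_language_iff_summary] at hz ⊢
    rwa [← T.summary_append_congr huv])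
  have := Fintype.card_le_of_injective _ hinj
  rw [card_finset_words] at this
  simp only [Fintype.card_prod, Fintype.card_set, Fintype.card_fin, ← pow_add] at this
  rw [sq]
  exact (Nat.pow_le_pow_iff_right (by norm_num)).1 this

/-- From `k ≤ k ^ 2` follows `2 ^ (n - 1) ≤ k ^ 2`; then square roots are taken. -/
theorem rpow_le_of_two_pow_le {n k : ℕ} (h : 2 ^ n ≤ k + k ^ 2) :
    (2 : ℝ) ^ (((n : ℝ) - 1) / 2) ≤ (k : ℝ) := by
  have h2 : 2 ^ n ≤ 2 * k ^ 2 := by nlinarith [Nat.le_self_pow two_ne_zero k]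
  have h3 : (2 : ℝ) ^ n ≤ 2 * (k : ℝ) ^ 2 := by exact_mod_cast h2
  refine le_of_sq_le_sq ?_ (Nat.cast_nonneg k)
  rw [← Real.rpow_natCast, ← Real.rpow_mul (by norm_num)]
  have h4 : ((n : ℝ) - 1) / 2 * ((2 : ℕ) : ℝ) = (n : ℝ) - 1 := by push_cast; ring
  rw [h4, Real.rpow_sub (by norm_num), Real.rpow_natCast, Real.rpow_one]
  linarith

/-! ### A once-marking machine for `blockLanguage n` -/

theorem exists_blocks {n : ℕ} {u : List Bool} (h : n ∣ u.length) :
    ∃ xs : List (List Bool), (∀ y ∈ xs, y.length = n) ∧ u = xs.flatten := by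
  obtain ⟨k, hk⟩ := h
  induction k generalizing u with
  | zero => exact ⟨[], by simp, List.length_eq_zero_iff.1 (by simpa using hk)⟩
  | succ k ih =>
    obtain ⟨xs, hxs, hu⟩ := ih (u := u.drop n) (by rw [List.length_drop, hk]; lia)
    refine ⟨u.take n :: xs, ?_, by rw [List.flatten_cons, ← hu, List.take_append_drop]⟩
    rintro y (_ | ⟨_, hy⟩)
    · rw [List.length_take, hk]
      lia
    · exact hxs y ‹_›

theorem length_flatten_of_forall {n : ℕ} {xs : List (List Bool)} (h : ∀ y ∈ xs, y.length = n) :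
    xs.flatten.length = xs.length * n := by
  have : xs.map List.length = List.replicate xs.length n :=
    List.eq_replicate_iff.2 ⟨by simp, by simpa using h⟩
  simp [List.length_flatten, this]

/-- The symbol with index `p + i` of `w` occurs again with an index congruent to `i` in the last
block of length `n`. -/
def MatchAt (n : ℕ) (w : List Bool) (p i : ℕ) : Prop :=
  ∃ j, p + i < j ∧ j < w.length ∧ w.length ≤ j + n ∧ j ≡ i [MOD n] ∧ w[j]? = w[p + i]?

theorem mem_blockLanguage_iff {n : ℕ} (hn : 0 < n) {w : List Bool} :
    w ∈ blockLanguage n ↔ n ∣ w.length ∧ ∃ p, n ∣ p ∧ p + n + n ≤ w.length ∧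
      ∀ i < n, w[w.length - n + i]? = w[p + i]? := by
  constructor
  · rintro ⟨xs, x, -, hxs, hx, hmem, rfl⟩
    obtain ⟨l₁, l₂, rfl⟩ := List.append_of_mem hmem
    have h1 := length_flatten_of_forall (xs := l₁) fun y hy => hxs y (by simp [hy])
    have h2 := length_flatten_of_forall (xs := l₂) fun y hy => hxs y (by simp [hy])
    have hlen : ((l₁ ++ x :: l₂).flatten ++ x).length =
        l₁.length * n + n + l₂.length * n + n := by
      simp only [List.flatten_append, List.flatten_cons, List.length_append, h1, h2, hx]
      ring
    refine ⟨?_, l₁.length * n, Dvd.intro_left _ rfl, by rw [hlen]; lia, fun i hi => ?_⟩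
    · exact ⟨l₁.length + l₂.length + 2, by rw [hlen]; ring⟩
    · rw [hlen, List.getElem?_append_right (by simp [h1, h2, hx]; lia)]
      rw [List.flatten_append, List.flatten_cons, List.append_assoc,
        List.getElem?_append_right (by lia), List.append_assoc,
        List.getElem?_append_left (by lia)]
      congr 1
      simp only [List.length_append, h1, h2, hx]
      lia
  · rintro ⟨hw, p, hp, hle, h⟩
    obtain ⟨l₁, hl₁, h₁⟩ := exists_blocks (n := n) (u := w.take p)
      (by rwa [List.length_take, min_eq_left (by lia)])
    obtain ⟨l₂, hl₂, h₂⟩ := exists_blocks (n := n) (u := (w.drop (p + n)).take (w.length - n - (p + n)))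
      (by
        rw [List.length_take, List.length_drop, min_eq_left (by lia)]
        exact Nat.dvd_sub (Nat.dvd_sub hw dvd_rfl) (dvd_add hp dvd_rfl))
    have hx : (w.drop p).take n = w.drop (w.length - n) := by
      apply List.ext_getElem?
      intro i
      rw [List.getElem?_take, List.getElem?_drop, List.getElem?_drop]
      split_ifs with hi
      · exact (h i hi).symm
      · rw [List.getElem?_eq_none (by lia)]
    refine ⟨l₁ ++ (w.drop p).take n :: l₂, (w.drop p).take n, by simp, ?_, ?_, by simp, ?_⟩
    · intro y hy
      simp only [List.mem_append, List.mem_cons] at hy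
      rcases hy with hy | rfl | hy
      · exact hl₁ y hy
      · rw [List.length_take, List.length_drop]
        lia
      · exact hl₂ y hy
    · rw [List.length_take, List.length_drop]
      lia
    · rw [List.flatten_append, List.flatten_cons, ← h₁, ← h₂]
      -- The word is cut into the blocks before `p`, the block at `p`, the blocks between, and the
      -- last block.
      have hsplit : w = w.take p ++ ((w.drop p).take n ++ ((w.drop (p + n)).take
          (w.length - n - (p + n)) ++ w.drop (w.length - n))) := by
        have h3 : w.drop (w.length - n) = (w.drop (p + n)).drop (w.length - n - (p + n)) := by
          rw [List.drop_drop]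
          congr 1
          lia
        rw [h3, List.take_append_drop, ← List.drop_drop, List.take_append_drop,
          List.take_append_drop]
      conv_lhs => rw [hsplit]
      rw [hx]
      simp only [List.append_assoc]

/-- Distinct congruent indices differ by at least `n`. So the match for `i` lies exactly at `|w| - n
+ i`, and the match for `0`, lying beyond `p`, leaves room for two blocks from `p` on. -/
theorem mem_blockLanguage_of_matchAt {n : ℕ} (hn : 0 < n) {w : List Bool} {p : ℕ}
    (hw : n ∣ w.length) (hp : n ∣ p) (h : ∀ i < n, MatchAt n w p i) : w ∈ blockLanguage n := by
  have hgap : ∀ {a b : ℕ}, a ≡ b [MOD n] → b < a → b + n ≤ a := by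
    intro a b h1 h2
    have := Nat.le_of_dvd (by lia) ((Nat.modEq_iff_dvd' h2.le).1 h1.symm)
    lia
  have hpi : ∀ i, p + i ≡ i [MOD n] := fun i => by
    simpa using (Nat.modEq_zero_iff_dvd.2 hp).add_right i
  have hwp : w.length ≡ p [MOD n] :=
    (Nat.modEq_zero_iff_dvd.2 hw).trans (Nat.modEq_zero_iff_dvd.2 hp).symm
  have hle : p + n + n ≤ w.length := by
    obtain ⟨j, h1, h2, h3, h4, -⟩ := h 0 hn
    have h5 := hgap (h4.trans (hpi 0).symm) h1
    have h6 : w.length ≡ p + n [MOD n] := hwp.trans (by simp [Nat.ModEq])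
    have h7 := hgap h6 (by lia)
    lia
  refine (mem_blockLanguage_iff hn).2 ⟨hw, p, hp, hle, fun i hi => ?_⟩
  obtain ⟨j, h1, h2, h3, h4, h5⟩ := h i hi
  have h6 : w.length - n + i ≡ i [MOD n] := by
    simpa using (Nat.modEq_zero_iff_dvd.2 (Nat.dvd_sub hw dvd_rfl)).add_right i
  have h7 : j = w.length - n + i := by
    rcases lt_trichotomy j (w.length - n + i) with hlt | heq | hlt
    · have := hgap (h6.trans h4.symm) hlt
      lia
    · exact heq
    · have := hgap (h4.trans h6.symm) hlt
      lia
  rw [← h7, h5]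

/-- The input `w` with a mark on the symbol with index `p`. -/
def markTape (w : List Bool) (p : ℕ) : List (WithMarks Bool) :=
  w.mapIdx fun i b => if i = p then Sum.inr b else Sum.inl b

@[simp] theorem length_markTape (w : List Bool) (p : ℕ) : (markTape w p).length = w.length := by
  simp [markTape]

theorem getElem?_markTape {w : List Bool} {p i : ℕ} {b : Bool} (h : w[i]? = some b) :
    (markTape w p)[i]? = some (if i = p then Sum.inr b else Sum.inl b) := by
  simp [markTape, h]

theorem set_eq_markTape {w : List Bool} {p : ℕ} {b : Bool} (h : w[p]? = some b) :
    (w.map Sum.inl).set p (Sum.inr b) = markTape w p := by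
  apply List.ext_getElem?
  intro i
  obtain ⟨hp, -⟩ := List.getElem?_eq_some_iff.1 h
  rcases eq_or_ne p i with rfl | hi
  · rw [getElem?_markTape h, List.getElem?_set_self (by simpa using hp), if_pos rfl]
  · rw [List.getElem?_set_ne hi]
    simp [markTape, hi.symm]

theorem isMarkedOnce_markTape {w : List Bool} {p : ℕ} (h : p < w.length) :
    IsMarkedOnce w (markTape w p) := by
  have hw : w = w.take p ++ w[p] :: w.drop (p + 1) := by
    rw [List.getElem_cons_drop, List.take_append_drop]
  refine ⟨w.take p, w.drop (p + 1), w[p], hw, ?_⟩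
  rw [← set_eq_markTape (List.getElem?_eq_getElem h), List.set_eq_take_append_cons_drop]
  simp [h, List.map_take, List.map_drop]

theorem tapeCell_succ_eq_some {Γ : Type*} {t : List Γ} {j : ℕ} {s : TapeSymbol Γ}
    (h : tapeCell t (j + 1) = some s) :
    (∃ g, t[j]? = some g ∧ s = .sym g) ∨ (j = t.length ∧ s = .rend) := by
  rcases lt_or_ge j t.length with hj | hj
  · exact .inl ⟨t[j], by simp, by simpa [tapeCell, hj] using h.symm⟩
  · simp only [tapeCell, List.getElem?_eq_none hj] at h
    split_ifs at h with hj'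
    exact .inr ⟨hj', (Option.some.inj h).symm⟩

theorem exists_getElem?_of_markTape {w : List Bool} {p j : ℕ} {s : WithMarks Bool}
    (h : tapeCell (markTape w p) (j + 1) = some (.sym s)) :
    ∃ b, w[j]? = some b ∧ s = if j = p then Sum.inr b else Sum.inl b := by
  rcases tapeCell_succ_eq_some h with ⟨g, hg, hs⟩ | ⟨-, hs⟩
  · cases hs
    have hj : j < w.length := by
      obtain ⟨hj, -⟩ := List.getElem?_eq_some_iff.1 hg
      simpa using hj
    have hb := List.getElem?_eq_getElem hj
    exact ⟨_, hb, Option.some.inj (hg.symm.trans (getElem?_markTape hb))⟩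
  · cases hs

/-! ### The machine and its invariant -/

namespace BlockMachine

/-- The phases of the machine: looking for the block to be marked, going back to the mark, going
from the mark to the next symbol of the marked block, comparing the symbol `σ` of this block with
the corresponding symbols of the following blocks, and having accepted. In the comparing phase,
`first` tells that `σ` is the marked symbol, and `eq` that the last comparison was successful. -/
inductive Phase where
  | search
  | back
  | seek
  | compare (first σ eq : Bool)
  | accept
  deriving DecidableEq, Fintype

/-- The transitions. The first component of a state is a counter modulo `n`, which is decreased by
the moves to the right and is zero at the symbols that are to be marked, read or compared. -/
inductive Trans (n : ℕ) : ZMod n × Phase → TapeSymbol (WithMarks Bool) → ZMod n × Phase →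
    WithMarks Bool → HeadMove → Prop
  | search (c : ZMod n) (b : Bool) :
      Trans n (c, .search) (.sym (.inl b)) (c - 1, .search) (.inl b) .right
  | mark (c : ZMod n) (b : Bool) (hc : c = 0) :
      Trans n (c, .search) (.sym (.inl b)) (c - 1, .compare true b false) (.inr b) .right
  | hit (c : ZMod n) (f σ m : Bool) (s : WithMarks Bool) (hc : c = 0) :
      Trans n (c, .compare f σ m) (.sym s) (c - 1, .compare f σ (s.elim id id == σ)) s .right
  | skip (c : ZMod n) (f σ m : Bool) (s : WithMarks Bool) (hc : c ≠ 0) :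
      Trans n (c, .compare f σ m) (.sym s) (c - 1, .compare f σ m) s .right
  | turn (c : ZMod n) (f σ : Bool) (hf : f = true → c = 0) (hc : c + 1 ≠ 0) :
      Trans n (c, .compare f σ true) .rend (c, .back) (.inl false) .left
  | accept (c : ZMod n) (f σ : Bool) (hf : f = true → c = 0) (hc : c + 1 = 0) :
      Trans n (c, .compare f σ true) .rend (c, .accept) (.inl false) .right
  | back (c : ZMod n) (b : Bool) :
      Trans n (c, .back) (.sym (.inl b)) (c, .back) (.inl b) .left
  | restart (c : ZMod n) (b : Bool) :
      Trans n (c, .back) (.sym (.inr b)) (c, .seek) (.inr b) .right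
  | load (c : ZMod n) (s : WithMarks Bool) (hc : c = 0) :
      Trans n (c, .seek) (.sym s) (c - 1, .compare false (s.elim id id) false) s .right
  | pass (c : ZMod n) (s : WithMarks Bool) (hc : c ≠ 0) :
      Trans n (c, .seek) (.sym s) (c - 1, .seek) s .right

/-- The machine that accepts `blockLanguage n`. -/
def machine (n : ℕ) : RewritingMachine Bool (WithMarks Bool) (ZMod n × Phase) where
  input := ⟨Sum.inl, Sum.inl_injective⟩
  δ q s := {x | Trans n q s x.1 x.2.1 x.2.2}
  init := (0, .search)
  final := {q | q.2 = .accept}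

/-- What holds in the phases after the symbol with index `p` has been marked, with the counter
`c` and the head in cell `k`. -/
def PhaseInv (n : ℕ) (w : List Bool) (p : ℕ) (c : ZMod n) (k : ℕ) : Phase → Prop
  | .search => False
  | .back => ∃ i j, i + 1 < n ∧ k = j + 1 ∧ p ≤ j ∧ n ∣ w.length ∧ c = i ∧
      ∀ i' ≤ i, MatchAt n w p i'
  | .seek => ∃ i j, i < n ∧ k = j + 1 ∧ p < j ∧ j ≤ p + i ∧ n ∣ w.length ∧
      c = (i : ZMod n) - j ∧ ∀ i' < i, MatchAt n w p i'
  | .compare f σ m => ∃ i j, i < n ∧ k = j + 1 ∧ p + i < j ∧ c = (i : ZMod n) - j ∧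
      w[p + i]? = some σ ∧ (m = true → ∃ j', p + i < j' ∧ j' < j ∧ j ≤ j' + n ∧
        j' ≡ i [MOD n] ∧ w[j']? = some σ) ∧
      (if f = true then i = 0 else n ∣ w.length) ∧ ∀ i' < i, MatchAt n w p i'
  | .accept => w ∈ blockLanguage n

/-- The invariant of the computations on input `w`. -/
def Inv (n : ℕ) (w : List Bool) (c : RewritingMachine.Config (WithMarks Bool) (ZMod n × Phase)) :
    Prop :=
  (c.state.2 = .search ∧ c.tape = w.map Sum.inl ∧ ∃ j, c.pos = j + 1 ∧
      c.state.1 = -(j : ZMod n) ∧ ∀ i ∈ c.visited, i ≤ j) ∨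
    ∃ p, p < w.length ∧ n ∣ p ∧ c.tape = markTape w p ∧ PhaseInv n w p c.state.1 c.pos c.state.2

theorem Trans.eq_of_sym {n : ℕ} {q q' : ZMod n × Phase} {s : TapeSymbol (WithMarks Bool)}
    {g : WithMarks Bool} {d : HeadMove} (h : Trans n q s q' g d) (hq : q.2 ≠ .search) :
    ∀ g', s = .sym g' → g = g' := by
  cases h <;> simp_all

theorem natCast_sub_eq_zero {n i j : ℕ} : (i : ZMod n) - j = 0 ↔ j ≡ i [MOD n] := by
  rw [sub_eq_zero, ZMod.natCast_eq_natCast_iff]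
  exact ⟨Nat.ModEq.symm, Nat.ModEq.symm⟩

theorem natCast_sub_of_dvd {n i l : ℕ} (h : n ∣ l) : (i : ZMod n) - l = i := by
  rw [(ZMod.natCast_eq_zero_iff l n).2 h, sub_zero]

theorem natCast_add_one_eq_zero {n i : ℕ} (hi : i < n) : (i : ZMod n) + 1 = 0 ↔ i + 1 = n := by
  rw [← Nat.cast_add_one, ZMod.natCast_eq_zero_iff]
  exact ⟨fun h => le_antisymm hi (Nat.le_of_dvd (Nat.succ_pos i) h), fun h => h ▸ dvd_rfl⟩

theorem phaseInv_of_trans {n : ℕ} (hn : 0 < n) {w : List Bool} {p : ℕ} (hp : p < w.length)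
    (hnp : n ∣ p) {c c' : ZMod n} {ph ph' : Phase} {k k' : ℕ} {s : TapeSymbol (WithMarks Bool)}
    {g : WithMarks Bool} {d : HeadMove} (hs : tapeCell (markTape w p) k = some s)
    (ht : Trans n (c, ph) s (c', ph') g d) (hd : HeadMoves d k k') (h : PhaseInv n w p c k ph) :
    PhaseInv n w p c' k' ph' := by
  -- Common to `turn` and `accept`: round `i` has succeeded. In the first round `i = 0`, so `c = 0`
  -- at the end says that `n` divides `|w|`; later rounds inherit this.
  have hend : ∀ {f σ : Bool}, PhaseInv n w p c k (.compare f σ true) → (f = true → c = 0) →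
      s = .rend → ∃ i, i < n ∧ k = w.length + 1 ∧ n ∣ w.length ∧ c = i ∧
        ∀ i' ≤ i, MatchAt n w p i' := by
    rintro f σ ⟨i, j, hi, rfl, hj, hc, hσ, hm, hf, hi'⟩ hfc rfl
    obtain ⟨_, -, hg⟩ | ⟨hjw, -⟩ := tapeCell_succ_eq_some hs
    · simp at hg
    rw [length_markTape] at hjw
    subst hjw
    have hdvd : n ∣ w.length := by
      split_ifs at hf with hft
      · rw [hfc hft, hf] at hc
        exact Nat.modEq_zero_iff_dvd.1 (natCast_sub_eq_zero.1 hc.symm)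
      · exact hf
    refine ⟨i, hi, rfl, hdvd, hc.trans (natCast_sub_of_dvd hdvd), fun i' hle => ?_⟩
    rcases hle.lt_or_eq with hlt | rfl
    · exact hi' i' hlt
    · obtain ⟨j', h1, h2, h3, h4, h5⟩ := hm rfl
      exact ⟨j', h1, h2, h3, h4, h5.trans hσ.symm⟩
  cases ht with
  | search => exact h.elim
  | mark => exact h.elim
  | hit _ f σ m s hc0 =>
    obtain ⟨i, j, hi, rfl, hj, hc, hσ, hm, hf, hi'⟩ := h
    refine ⟨i, j + 1, hi, hd, by lia, by rw [hc]; push_cast; ring, hσ, fun heq => ?_, hf, hi'⟩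
    obtain ⟨b, hb, rfl⟩ := exists_getElem?_of_markTape hs
    rw [if_neg (by lia)] at heq
    refine ⟨j, hj, by lia, by lia, natCast_sub_eq_zero.1 (hc.symm.trans hc0), ?_⟩
    rw [hb]
    simpa using heq
  | skip _ f σ m s hc0 =>
    obtain ⟨i, j, hi, rfl, hj, hc, hσ, hm, hf, hi'⟩ := h
    refine ⟨i, j + 1, hi, hd, by lia, by rw [hc]; push_cast; ring, hσ, fun heq => ?_, hf, hi'⟩
    obtain ⟨j', h1, h2, h3, h4, h5⟩ := hm heq
    refine ⟨j', h1, by lia, ?_, h4, h5⟩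
    -- If `j = j' + n`, then `j` is congruent to `i` and the counter is zero, which rules out a
    -- skip.
    rcases h3.lt_or_eq with h3 | rfl
    · exact h3
    · exact absurd (hc.trans (natCast_sub_eq_zero.2 (by simpa [Nat.ModEq] using h4))) hc0
  | turn _ f σ hf hc =>
    obtain ⟨i, hi, rfl, hw, rfl, hi'⟩ := hend h hf rfl
    rw [Ne, natCast_add_one_eq_zero hi] at hc
    simp only [HeadMoves] at hd
    exact ⟨i, w.length - 1, by lia, by lia, by lia, hw, rfl, hi'⟩
  | accept _ f σ hf hc =>
    obtain ⟨i, hi, rfl, hw, rfl, hi'⟩ := hend h hf rfl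
    rw [natCast_add_one_eq_zero hi] at hc
    exact mem_blockLanguage_of_matchAt hn hw hnp fun i' hlt => hi' i' (by lia)
  | back _ b =>
    obtain ⟨i, j, hi, rfl, hj, hw, hc, hi'⟩ := h
    obtain ⟨b', hb, hb'⟩ := exists_getElem?_of_markTape hs
    have hjp : j ≠ p := by
      rintro rfl
      simp at hb'
    simp only [HeadMoves] at hd
    exact ⟨i, j - 1, hi, by lia, by lia, hw, hc, hi'⟩
  | restart _ b =>
    obtain ⟨i, j, hi, rfl, hj, hw, hc, hi'⟩ := h
    obtain ⟨b', hb, hb'⟩ := exists_getElem?_of_markTape hs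
    have hjp : j = p := by
      by_contra hne
      simp [hne] at hb'
    subst hjp
    -- The counter is not decreased: as `n` divides `j = p`, its value `i` equals `(i + 1) - (j +
    -- 1)`, the value for the next round.
    refine ⟨i + 1, j + 1, hi, hd, by lia, by lia, hw, ?_, fun i' hlt => hi' i' (by lia)⟩
    rw [hc]
    push_cast
    rw [(ZMod.natCast_eq_zero_iff j n).2 hnp]
    ring
  | load _ s hc0 =>
    obtain ⟨i, j, hi, rfl, hj, hji, hw, hc, hi'⟩ := h
    obtain ⟨b, hb, rfl⟩ := exists_getElem?_of_markTape hs
    have hij : j = p + i := by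
      have h1 : j ≡ i [MOD n] := natCast_sub_eq_zero.1 (hc.symm.trans hc0)
      have h2 : p + i ≡ i [MOD n] := by simpa using (Nat.modEq_zero_iff_dvd.2 hnp).add_right i
      have h3 := (Nat.modEq_iff_dvd' hji).1 (h1.trans h2.symm)
      have h4 := Nat.eq_zero_of_dvd_of_lt h3 (by lia)
      lia
    subst hij
    refine ⟨i, p + i + 1, hi, hd, by lia, by rw [hc]; push_cast; ring, ?_, by simp, by simpa, hi'⟩
    rw [hb, if_neg (by lia)]
    rfl
  | pass _ s hc0 =>
    obtain ⟨i, j, hi, rfl, hj, hji, hw, hc, hi'⟩ := h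
    refine ⟨i, j + 1, hi, hd, by lia, ?_, hw, by rw [hc]; push_cast; ring, hi'⟩
    rcases hji.lt_or_eq with h1 | rfl
    · exact h1
    · refine absurd (hc.trans (natCast_sub_eq_zero.2 ?_)) hc0
      simpa using (Nat.modEq_zero_iff_dvd.2 hnp).add_right i

theorem inv_of_step {n : ℕ} (hn : 0 < n) {w : List Bool}
    {c c' : RewritingMachine.Config (WithMarks Bool) (ZMod n × Phase)} (h : Inv n w c)
    (hstep : (machine n).Step c c') : Inv n w c' := by
  obtain ⟨⟨a, ph⟩, k, t, vis⟩ := c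
  obtain ⟨⟨a', ph'⟩, k', t', vis'⟩ := c'
  obtain ⟨s, g, d, hs, ht, hd, hwr, hvis⟩ := hstep
  simp only at hs hd hwr hvis
  replace ht : Trans n (a, ph) s (a', ph') g d := ht
  rcases h with ⟨hph, htape, j, hk, ha, hv⟩ | ⟨p, hp, hnp, htape, hinv⟩
  · simp only at hph htape hk ha hv
    subst hph htape hk hvis
    cases ht with
    | search _ b =>
      refine .inl ⟨rfl, ?_, j + 1, hd, ?_, ?_⟩
      · exact hwr.trans (RewritingMachine.write_eq_self hs (by simp))
      · simp only [ha]
        push_cast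
        ring
      · rintro i (rfl | hi)
        · exact le_rfl
        · exact (hv i hi).trans (Nat.le_succ j)
    | mark _ b hc =>
      have hb : w[j]? = some b := by
        rcases tapeCell_succ_eq_some hs with ⟨g, hg, hg'⟩ | ⟨-, hg'⟩
        · cases hg'
          simpa using hg
        · cases hg'
      obtain ⟨hj, -⟩ := List.getElem?_eq_some_iff.1 hb
      have hnj : n ∣ j := by
        rw [← ZMod.natCast_eq_zero_iff, ← neg_eq_zero, ← ha, hc]
      refine .inr ⟨j, hj, hnj, ?_, 0, j + 1, hn, hd, by lia, ?_, by simpa, by simp, by simp,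
        by simp⟩
      · rw [hwr]
        exact set_eq_markTape hb
      · simp only [ha]
        push_cast
        ring
  · simp only at htape hinv
    subst htape
    have hne : ph ≠ .search := by
      rintro rfl
      exact hinv
    refine .inr ⟨p, hp, hnp, ?_, phaseInv_of_trans hn hp hnp hs ht hd hinv⟩
    exact hwr.trans (RewritingMachine.write_eq_self hs (ht.eq_of_sym hne))

theorem inv_of_reaches {n : ℕ} (hn : 0 < n) {w : List Bool}
    {c : RewritingMachine.Config (WithMarks Bool) (ZMod n × Phase)}
    (h : (machine n).Reaches w c) : Inv n w c := by
  induction h with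
  | refl => exact .inl ⟨rfl, rfl, 0, rfl, by simp [RewritingMachine.initial, machine],
      fun i hi => hi.elim⟩
  | tail _ hstep ih => exact inv_of_step hn ih hstep

/-- During the search the head is always on an unvisited cell, and after the mark every transition
rewrites the symbol it reads. -/
theorem isOnceMarking_machine {n : ℕ} (hn : 0 < n) : (machine n).IsOnceMarking where
  input_eq _ := rfl
  oneLimited w _ _ hc hstep hvis := by
    obtain ⟨s, g, d, hs, ht, -, hwr, -⟩ := hstep
    rcases inv_of_reaches hn hc with ⟨-, -, j, hk, -, hv⟩ | ⟨p, -, -, -, hinv⟩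
    · have := hv _ hvis
      lia
    · refine hwr.trans (RewritingMachine.write_eq_self hs (Trans.eq_of_sym ht fun hph => ?_))
      rw [hph] at hinv
      exact hinv
  marks w c hc := by
    rcases inv_of_reaches hn hc with ⟨-, h, -⟩ | ⟨p, hp, -, h, -⟩
    · exact .inl h
    · exact .inr (h ▸ isMarkedOnce_markTape hp)

theorem marksWhenAccepting_machine {n : ℕ} (hn : 0 < n) : (machine n).MarksWhenAccepting := by
  rintro w c hc ⟨hfin, -⟩
  rcases inv_of_reaches hn hc with ⟨h, -⟩ | ⟨p, hp, -, h, -⟩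
  · cases h.symm.trans hfin
  · exact h ▸ isMarkedOnce_markTape hp

theorem language_subset {n : ℕ} (hn : 0 < n) {w : List Bool} (hw : w ∈ (machine n).language) :
    w ∈ blockLanguage n := by
  obtain ⟨c, hc, hfin, -⟩ := hw
  rcases inv_of_reaches hn hc with ⟨h, -⟩ | ⟨p, hp, -, -, hinv⟩
  · cases h.symm.trans hfin
  · rw [show c.state.2 = .accept from hfin] at hinv
    exact hinv

/-! ### Accepting computations on the words of the language -/

theorem step_readOnly {n : ℕ} {t : List (WithMarks Bool)} {q q' : ZMod n × Phase} {k k' : ℕ}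
    {s : TapeSymbol (WithMarks Bool)} {g : WithMarks Bool} {d : HeadMove}
    (hs : tapeCell t k = some s) (ht : Trans n q s q' g d) (hg : ∀ g', s = .sym g' → g = g')
    (hd : HeadMoves d k k') :
    TwoWay.Step (machine n).readOnly (leftTape t ++ [.rend]) (q, k) (q', k') :=
  ⟨s, d, (tapeCell_eq_getElem? t k).symm.trans hs, ⟨g, ht, hg⟩, hd⟩

theorem run_search {n : ℕ} {w : List Bool} {j : ℕ} (hj : j ≤ w.length) :
    TwoWay.Run (machine n).readOnly (leftTape (w.map Sum.inl) ++ [.rend]) ((0, .search), 1)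
      ((-(j : ZMod n), .search), j + 1) := by
  induction j with
  | zero =>
    rw [Nat.cast_zero, neg_zero]
    exact .refl
  | succ j ih =>
    refine (ih (by lia)).tail ?_
    have hc : -((j + 1 : ℕ) : ZMod n) = -(j : ZMod n) - 1 := by
      push_cast
      ring
    rw [hc]
    exact step_readOnly (s := .sym (.inl w[j])) (by simp [tapeCell, show j < w.length from hj])
      (.search _ _) (by simp) rfl

theorem tapeCell_markTape {w : List Bool} {p j : ℕ} {b : Bool} (h : w[j]? = some b) :
    tapeCell (markTape w p) (j + 1) = some (.sym (if j = p then Sum.inr b else Sum.inl b)) := by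
  simp [tapeCell, getElem?_markTape h]

section Accepting

variable {n : ℕ} {w : List Bool} {p : ℕ}

/-- The last comparison takes place at index `|w| - n + i` and overwrites all earlier outcomes, so
`m` matters only beyond this index. -/
theorem run_compare (hw : n ∣ w.length) (hle : p + n + n ≤ w.length) {i : ℕ} (hi : i < n)
    {σ : Bool} (h : w[w.length - n + i]? = some σ) (f : Bool) {j : ℕ}
    (hj : j ≤ w.length) : p + i < j → ∀ m : Bool, (w.length - n + i < j → m = true) →
    TwoWay.Run (machine n).readOnly (leftTape (markTape w p) ++ [.rend])
      (((i : ZMod n) - j, .compare f σ m), j + 1) (((i : ZMod n), .compare f σ true),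
        w.length + 1) := by
  induction hj using Nat.decreasingInduction with
  | self =>
    intro hij m hm
    rw [hm (by lia), natCast_sub_of_dvd hw]
    exact .refl
  | of_succ j hj ih =>
    intro hij m hm
    have hmod : w.length - n + i ≡ i [MOD n] := by
      simpa using (Nat.modEq_zero_iff_dvd.2 (Nat.dvd_sub hw dvd_rfl)).add_right i
    have hcell := tapeCell_markTape (p := p) (List.getElem?_eq_getElem hj)
    rw [if_neg (by lia)] at hcell
    have hc : (i : ZMod n) - ((j + 1 : ℕ) : ZMod n) = (i : ZMod n) - j - 1 := by
      push_cast
      ring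
    by_cases hc0 : (i : ZMod n) - j = 0
    · refine .head (step_readOnly hcell (.hit _ _ _ _ _ hc0) (by simp) rfl) ?_
      rw [← hc]
      refine ih (by lia) _ fun hlt => ?_
      have heq : j = w.length - n + i := by
        by_contra hne
        have := Nat.le_of_dvd (by lia) ((Nat.modEq_iff_dvd' (by lia)).1
          (hmod.trans (natCast_sub_eq_zero.1 hc0).symm))
        lia
      have : w[j] = σ := by
        rw [← heq] at h
        exact (List.getElem?_eq_some_iff.1 h).2
      simp [this]
    · refine .head (step_readOnly hcell (.skip _ _ _ _ _ hc0) (by simp) rfl) ?_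
      rw [← hc]
      refine ih (by lia) _ fun hlt => hm ?_
      refine lt_of_le_of_ne (by lia) ?_
      rintro rfl
      exact hc0 (natCast_sub_eq_zero.2 hmod)

theorem run_back (c : ZMod n) {j : ℕ} (hpj : p ≤ j) : j < w.length →
    TwoWay.Run (machine n).readOnly (leftTape (markTape w p) ++ [.rend])
      ((c, .back), j + 1) ((c, .seek), p + 2) := by
  induction j, hpj using Nat.le_induction with
  | base =>
    intro hj
    have hcell := tapeCell_markTape (p := p) (List.getElem?_eq_getElem hj)
    rw [if_pos rfl] at hcell
    exact .single (step_readOnly hcell (.restart _ _) (by simp) rfl)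
  | succ j hpj ih =>
    intro hj
    have hcell := tapeCell_markTape (p := p) (List.getElem?_eq_getElem hj)
    rw [if_neg (by lia)] at hcell
    exact .head (step_readOnly hcell (.back _ _) (by simp) rfl) (ih (by lia))

theorem run_seek (hp : n ∣ p) {i : ℕ} (hi : i < n) {σ : Bool} (hσ : w[p + i]? = some σ) {j : ℕ}
    (hj : j ≤ p + i) : p < j →
    TwoWay.Run (machine n).readOnly (leftTape (markTape w p) ++ [.rend])
      (((i : ZMod n) - j, .seek), j + 1)
      (((i : ZMod n) - (p + i + 1 : ℕ), .compare false σ false), p + i + 2) := by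
  have hc : ∀ j : ℕ, (i : ZMod n) - ((j + 1 : ℕ) : ZMod n) = (i : ZMod n) - j - 1 := by
    intro j
    push_cast
    ring
  induction hj using Nat.decreasingInduction with
  | self =>
    intro hpj
    have hcell := tapeCell_markTape (p := p) hσ
    rw [if_neg (by lia)] at hcell
    rw [hc]
    refine .single (step_readOnly hcell (.load _ _ (natCast_sub_eq_zero.2 ?_)) (by simp) rfl)
    simpa using (Nat.modEq_zero_iff_dvd.2 hp).add_right i
  | of_succ j hj ih =>
    intro hpj
    obtain ⟨hlt, -⟩ := List.getElem?_eq_some_iff.1 hσ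
    have hcell := tapeCell_markTape (p := p)
      (List.getElem?_eq_getElem (show j < w.length by lia))
    rw [if_neg (by lia)] at hcell
    refine .head (step_readOnly hcell (.pass _ _ fun hc0 => ?_) (by simp) rfl) (hc j ▸ ih (by lia))
    have h1 := natCast_sub_eq_zero.1 hc0
    have h2 : p + i ≡ i [MOD n] := by simpa using (Nat.modEq_zero_iff_dvd.2 hp).add_right i
    have h3 := Nat.eq_zero_of_dvd_of_lt ((Nat.modEq_iff_dvd' hj.le).1 (h1.trans h2.symm))
      (by lia)
    lia

/-- Descending induction on the round: round `n - 1` accepts, and an earlier one goes back to the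
mark and seeks the next symbol. -/
theorem run_accept (hw : n ∣ w.length) (hp : n ∣ p) (hle : p + n + n ≤ w.length)
    (h : ∀ i < n, w[w.length - n + i]? = w[p + i]?) {i : ℕ} (hi : i ≤ n - 1) : i < n →
    ∀ (f σ : Bool), w[p + i]? = some σ → (f = true → i = 0) →
    ∃ c, TwoWay.Run (machine n).readOnly (leftTape (markTape w p) ++ [.rend])
      (((i : ZMod n) - (p + i + 1 : ℕ), .compare f σ false), p + i + 2)
      ((c, .accept), w.length + 2) := by
  have hcell : tapeCell (markTape w p) (w.length + 1) = some .rend := by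
    rw [← length_markTape w p]
    simp [tapeCell]
  induction hi using Nat.decreasingInduction with
  | self =>
    intro hn f σ hσ hf
    refine ⟨((n - 1 : ℕ) : ZMod n), (run_compare hw hle hn ((h _ hn).trans hσ) f (by lia) (by lia)
      false (by lia)).tail (step_readOnly hcell (.accept _ _ _ (fun hft => ?_) ?_) (by simp) rfl)⟩
    · rw [hf hft, Nat.cast_zero]
    · rw [natCast_add_one_eq_zero hn]
      lia
  | of_succ i hi ih =>
    intro hn f σ hσ hf
    have hlt : p + (i + 1) < w.length := by lia
    obtain ⟨c, hc⟩ := ih (by lia) false w[p + (i + 1)] (List.getElem?_eq_getElem hlt) (by simp)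
    refine ⟨c, Relation.ReflTransGen.trans ((run_compare hw hle hn ((h _ hn).trans hσ) f (by lia)
      (by lia) false (by lia)).tail (step_readOnly (k' := w.length) hcell
        (.turn _ _ _ (fun hft => ?_) ?_) (by simp) rfl)) ?_⟩
    · rw [hf hft, Nat.cast_zero]
    · rw [Ne, natCast_add_one_eq_zero hn]
      lia
    · have hback := run_back (w := w) (i : ZMod n) (show p ≤ w.length - 1 by lia) (by lia)
      rw [Nat.sub_add_cancel (by lia)] at hback
      refine Relation.ReflTransGen.trans hback (Relation.ReflTransGen.trans ?_ hc)
      have hseek := run_seek hp (show i + 1 < n by lia) (List.getElem?_eq_getElem hlt)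
        (show p + 1 ≤ p + (i + 1) by lia) (by lia)
      have hstart : ((i + 1 : ℕ) : ZMod n) - (p + 1 : ℕ) = i := by
        push_cast
        rw [(ZMod.natCast_eq_zero_iff p n).2 hp]
        ring
      rwa [hstart] at hseek

end Accepting

/-- The accepting computation consists of two read-only runs, on the plain and on the marked tape,
joined by the marking move. -/
theorem subset_language {n : ℕ} (hn : 0 < n) {w : List Bool} (hw : w ∈ blockLanguage n) :
    w ∈ (machine n).language := by
  obtain ⟨hnw, p, hp, hle, h⟩ := (mem_blockLanguage_iff hn).1 hw
  have hlt : p < w.length := by lia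
  have hwp := List.getElem?_eq_getElem hlt
  obtain ⟨vis, hvis⟩ := RewritingMachine.Reaches.of_run (M := machine n) (w := w)
    (t := w.map Sum.inl) (fun i s h => (tapeCell_eq_getElem? _ _).trans h) (run_search hlt.le)
    ⟨∅, .refl⟩
  have hmark : (machine n).Reaches w
      ⟨(-(p : ZMod n) - 1, .compare true w[p] false), p + 2, markTape w p,
        insert (p + 1) vis⟩ := by
    refine hvis.tail ⟨.sym (.inl w[p]), .inr w[p], .right, by simp [tapeCell, hlt], ?_, rfl,
      (set_eq_markTape hwp).symm, rfl⟩
    refine Trans.mark _ _ ?_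
    rw [(ZMod.natCast_eq_zero_iff p n).2 hp, neg_zero]
  obtain ⟨c, hrun⟩ := run_accept hnw hp hle h (Nat.zero_le _) hn true w[p] hwp (fun _ => rfl)
  have hstart : ((0 : ℕ) : ZMod n) - (p + 0 + 1 : ℕ) = -(p : ZMod n) - 1 := by
    push_cast
    ring
  rw [hstart] at hrun
  obtain ⟨vis', hvis'⟩ := RewritingMachine.Reaches.of_run (M := machine n) (w := w)
    (fun i s h => (tapeCell_eq_getElem? _ _).trans h) hrun ⟨_, hmark⟩
  exact ⟨_, hvis', rfl, by simp⟩

theorem language_machine {n : ℕ} (hn : 0 < n) : (machine n).language = blockLanguage n :=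
  Set.Subset.antisymm (fun _ => language_subset hn) (fun _ => subset_language hn)

end BlockMachine

/-! ### Renaming of states -/

namespace RewritingMachine

variable {α Γ Q Q' : Type*}

/-- A machine with renamed states. -/
def mapStates (M : RewritingMachine α Γ Q) (e : Q ≃ Q') : RewritingMachine α Γ Q' where
  input := M.input
  δ q s := {x | (e.symm x.1, x.2) ∈ M.δ (e.symm q) s}
  init := e M.init
  final := e.symm ⁻¹' M.final

/-- A configuration with a renamed state. -/
def Config.mapState (f : Q → Q') (c : Config Γ Q) : Config Γ Q' :=
  ⟨f c.state, c.pos, c.tape, c.visited⟩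

theorem step_mapStates {M : RewritingMachine α Γ Q} {e : Q ≃ Q'} {c c' : Config Γ Q'} :
    (M.mapStates e).Step c c' ↔ M.Step (c.mapState e.symm) (c'.mapState e.symm) :=
  Iff.rfl

theorem reaches_mapStates {M : RewritingMachine α Γ Q} {e : Q ≃ Q'} {w : List α}
    {c : Config Γ Q'} : (M.mapStates e).Reaches w c ↔ M.Reaches w (c.mapState e.symm) := by
  have hinit : ((M.mapStates e).initial w).mapState e.symm = M.initial w := by
    simp [Config.mapState, initial, mapStates]
  constructor
  · intro h
    rw [Reaches, ← hinit]
    exact Relation.ReflTransGen.lift _ (fun _ _ h => step_mapStates.1 h) _ _ h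
  · intro h
    have h' : Relation.ReflTransGen (M.mapStates e).Step ((M.initial w).mapState e)
        ((c.mapState e.symm).mapState e) :=
      Relation.ReflTransGen.lift (Config.mapState e)
        (fun a b h => step_mapStates.2 (by simpa [Config.mapState] using h)) _ _ h
    simpa [Config.mapState, initial, mapStates, Reaches] using h'

theorem language_mapStates (M : RewritingMachine α Γ Q) (e : Q ≃ Q') :
    (M.mapStates e).language = M.language := by
  ext w
  constructor
  · rintro ⟨c, hc, hacc⟩
    exact ⟨_, reaches_mapStates.1 hc, hacc⟩
  · rintro ⟨c, hc, hacc⟩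
    refine ⟨c.mapState e, reaches_mapStates.2 (by simpa [Config.mapState] using hc), ?_, hacc.2⟩
    simpa [Config.mapState, mapStates] using hacc.1

theorem IsOnceMarking.mapStates {M : RewritingMachine α (WithMarks α) Q} (hM : M.IsOnceMarking)
    (e : Q ≃ Q') : (M.mapStates e).IsOnceMarking where
  input_eq := hM.input_eq
  oneLimited w _ _ hc hstep hvis :=
    hM.oneLimited w _ _ (reaches_mapStates.1 hc) (step_mapStates.1 hstep) hvis
  marks w _ hc := hM.marks w _ (reaches_mapStates.1 hc)

theorem MarksWhenAccepting.mapStates {M : RewritingMachine α (WithMarks α) Q}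
    (hM : M.MarksWhenAccepting) (e : Q ≃ Q') : (M.mapStates e).MarksWhenAccepting :=
  fun w _ hc hacc => hM w _ (reaches_mapStates.1 hc) hacc

end RewritingMachine

theorem exists_onceMarking_blockLanguage {n : ℕ} (hn : 0 < n) :
    ∃ m ≤ Fintype.card BlockMachine.Phase * n, ∃ M : RewritingMachine Bool (WithMarks Bool) (Fin m),
      M.IsOnceMarking ∧ M.MarksWhenAccepting ∧ M.language = blockLanguage n := by
  have : NeZero n := ⟨hn.ne'⟩
  let e := Fintype.equivFin (ZMod n × BlockMachine.Phase)
  refine ⟨_, ?_, (BlockMachine.machine n).mapStates e,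
    (BlockMachine.isOnceMarking_machine hn).mapStates e,
    (BlockMachine.marksWhenAccepting_machine hn).mapStates e,
    (RewritingMachine.language_mapStates _ e).trans (BlockMachine.language_machine hn)⟩
  rw [Fintype.card_prod, ZMod.card, mul_comm]

theorem theorem4 :
    -- upper bounds
    (∀ (α : Type*) [Fintype α] (Q : Type*) [Fintype Q]
        (M : RewritingMachine α (WithMarks α) Q) (n : ℕ),
      M.IsOnceMarking → Fintype.card Q = n →
        (∃ k ≤ n * 2 ^ (n ^ 2), ∃ N : NFA α (Fin k),
          (∃ q₀, N.start = {q₀}) ∧ N.accepts = M.language) ∧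
        (∃ k ≤ n * 2 ^ (n ^ 2), ∃ T : TwoWayNFA α (Fin k), T.language = M.language) ∧
        (∃ k ≤ 2 ^ (n * 2 ^ (n ^ 2)), ∃ D : DFA α (Fin k), D.accepts = M.language)) ∧
    -- `K_n` is accepted by a once-marking 1-limited automaton with `O(n)` states
    (∃ C : ℕ, ∀ n : ℕ, 0 < n →
      ∃ m ≤ C * n, ∃ M : RewritingMachine Bool (WithMarks Bool) (Fin m),
        M.IsOnceMarking ∧ M.MarksWhenAccepting ∧ M.language = blockLanguage n) ∧
    -- lower bounds for the finite automata that accept `K_n`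
    (∀ n : ℕ, 0 < n →
      (∀ (k : ℕ) (N : NFA Bool (Fin k)), N.accepts = blockLanguage n → 2 ^ n ≤ k) ∧
      (∀ (k : ℕ) (T : TwoWayNFA Bool (Fin k)), T.language = blockLanguage n →
        (2 : ℝ) ^ (((n : ℝ) - 1) / 2) ≤ (k : ℝ)) ∧
      (∀ (k : ℕ) (N : NFA Bool (Fin k)), N.IsPartialDFA → N.accepts = blockLanguage n →
        2 ^ (2 ^ n) ≤ k)) := by
  refine ⟨?_, ⟨_, fun n hn => exists_onceMarking_blockLanguage hn⟩, fun n hn =>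
    ⟨fun k N hN => two_pow_le_of_nfa hn hN,
      fun k T hT => rpow_le_of_two_pow_le (two_pow_le_of_twoWayNFA hn hT),
      fun k N hdet hN => two_pow_two_pow_le_of_isPartialDFA hn hdet hN⟩⟩
  rintro α _ Q _ M n hM rfl
  obtain ⟨k, rfl, hN, hT, hD⟩ := hM.oneLimited.exists_automata
  exact ⟨⟨_, le_rfl, hN⟩, ⟨_, le_rfl, hT⟩, ⟨_, le_rfl, hD⟩⟩
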